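/- Throughout, $d\alpha(X,Y)=\frac12\big(X\alpha(Y)-Y\alpha(X)-\alpha([X,Y])\big)$ and $\alpha\wedge\beta=\frac12(\alpha\otimes\beta-\beta\otimes\alpha)$ for $1$-forms. Let $0<q<n$ and let $\overline M$ be a complex manifold of complex dimension $2n+1$, with complex structure $J$, a semi-Riemannian metric $\overline g$ of index $4q$ that is Hermitian ($\overline g(JX,JY)=\overline g(X,Y)$), and an open covering $\{\mathcal O_i\}$ such that: (a) on each $\mathcal O_i$ there is a holomorphic $1$-form $\theta_i$ with $\theta_i\wedge(d\theta_i)^n\neq0$ everywhere, and on $\mathcal O_i\cap\mathcal O_j$ one has $\theta_i=f_{ij}\theta_j$ with $f_{ij}$ holomorphic and nowhere zero; (b) on each $\mathcal O_i$ there are smooth real $1$-forms $u,\sigma$, a vector field $U$ and a $(1,1)$-tensor $G$ such that, with $v=u\circ J$, $V=-JU$, $H=GJ$: $G^2=H^2=-I+u\otimes U+v\otimes V$, $\overline g(GX,Y)=-\overline g(X,GY)$, $\overline g(U,X)=u(X)$, $GJ=-JG$, $GU=0$, $u(U)=1$, $du(X,Y)=\overline g(X,GY)+(\sigma\wedge v)(X,Y)$,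 $dv(X,Y)=\overline g(X,HY)-(\sigma\wedge u)(X,Y)$, and $\theta_i$ is a nowhere zero complex multiple of $u-iv$; on $\mathcal O_i\cap\mathcal O_j$ there are real functions $a,b$ with $a^2+b^2=1$ and $u_j=au_i-bv_i$, $v_j=bu_i+av_i$, $G_j=aG_i-bH_i$, $H_j=bG_i+aH_i$. That is, $\overline M$ is an indefinite complex contact (metric) manifold. Let $\mathcal H=\ker u\cap\ker v$, let $\mathcal V=\mathrm{Span}\{U,V\}$ be the characteristic subbundle, let $[G,G](X,Y)=G^2[X,Y]+[GX,GY]-G[GX,Y]-G[X,GY]$, similarly $[H,H]$, and $$\begin{aligned}S(X,Y)={}&[G,G](X,Y)+2\overline g(X,GY)U-2\overline g(X,HY)V+2\{v(Y)HX-v(X)HY\}\\&+\sigma(GY)HX-\sigma(GX)HY+\sigma(X)GHY-\sigma(Y)GHX,\\ T(X,Y)={}&[H,H](X,Y)-2\overline g(X,GY)U+2\overline g(X,HY)V+2\{u(Y)GX-u(X)GY\}\\&+\sigma(HX)GY-\sigma(HY)GX+\sigma(X)GHY-\sigma(Y)GHX.\end{aligned}$$ Suppose that $\overline M$ is normal: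 $S(X,Y)=T(X,Y)=0$ for all $X,Y\in\Gamma(\mathcal H)$ and $S(U,X)=T(V,X)=0$ for all $X\in\Gamma(T\overline M)$. Let $(M,g)$ be a nonempty (immersed) null hypersurface of $\overline M$: it has real codimension one, the induced tensor $g$ has constant rank $\dim M-1$, and the normal bundle $TM^\perp$ has rank one. Suppose that $M$ is tangent to the characteristic subbundle, $\mathcal V\subset TM$. Let $S(TM)$ be a screen distribution of $M$, i.e. a smooth distribution complementary to $TM^\perp$ in $TM$, and let $P:TM\to S(TM)$ be the projection along $TM^\perp$. For a local nowhere zero section $\xi$ of $TM^\perp$ let $N$ be the local section of $T\overline M|_M$ with $\overline g(\xi,N)=1$ and $\overline g(N,N)=\overline g(N,Z)=0$ for all $Z\in\Gamma(S(TM))$. The local second fundamental forms $B$, $C$ are defined, for $X,Y\in\Gamma(TM)$, by $\overline\nabla_XY=\nabla_XY+B(X,Y)N$ and $\nabla_XPY=\nabla^*_XPY+C(X,PY)\xi$, where $\overline\nabla$ is the Levi-Civita connection of $\overline g$, $\nabla_XY\in\Gamma(TM)$ and $\nabla^*_XPY\in\Gamma(S(TM))$. Then: 1. $M$ is not totally umbilic: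 it is impossible that around each point of $M$ there are such $\xi,N$ and a smooth function $\rho$ with $B(X,PY)=\rho\,g(X,Y)$ for all $X,Y\in\Gamma(TM)$. If moreover $\mathcal V\subset S(TM)$, then: 2. $M$ is not screen totally umbilic: it is impossible that around each point of $M$ there are such $\xi,N$ and a smooth function $\varrho$ with $C(X,PY)=\varrho\,g(X,Y)$ for all $X,Y\in\Gamma(TM)$. 3. $M$ is not screen conformal: it is impossible that around each point of $M$ there are such $\xi,N$ and a nowhere zero smooth function $\psi$ with $C(X,PY)=\psi\,B(X,Y)$ for all $X,Y\in\Gamma(TM)$. -/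

import Mathlib

open scoped Manifold ContDiff Topology

noncomputable section

namespace ComplexContact

/-! ### Coordinate fields, differential forms and the Nijenhuis tensor -/

section Forms

variable {𝕜 : Type*} [RCLike 𝕜] {E : Type*} [NormedAddCommGroup E] [NormedSpace 𝕜 E]
  {M : Type*} [TopologicalSpace M] [ChartedSpace E M] [IsManifold 𝓘(𝕜, E) ∞ M]

variable (𝕜 E) in
/-- The components of a tangent vector at `y` in the preferred chart at `x`. -/
def coords (x y : M) : TangentSpace 𝓘(𝕜, E) y →L[𝕜] E :=
  (trivializationAt E (TangentSpace 𝓘(𝕜, E) : M → Type _) x).continuousLinearMapAt 𝕜 y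

variable (𝕜 E) in
/-- The tangent vector at `y` with given components in the preferred chart at `x`. -/
def ofCoords (x y : M) : E →L[𝕜] TangentSpace 𝓘(𝕜, E) y :=
  (trivializationAt E (TangentSpace 𝓘(𝕜, E) : M → Type _) x).symmL 𝕜 y

/-- The extension of `a ∈ T_x M` to the vector field near `x` that has constant components in the
preferred chart at `x`. Any two of these fields commute. -/
def coordField {x : M} (a : TangentSpace 𝓘(𝕜, E) x) (y : M) : TangentSpace 𝓘(𝕜, E) y :=
  ofCoords 𝕜 E x y (coords 𝕜 E x x a)

/-- A vector field is smooth at `x`. -/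
def SmoothFieldAt (X : Π x : M, TangentSpace 𝓘(𝕜, E) x) (x : M) : Prop :=
  ContMDiffAt 𝓘(𝕜, E) 𝓘(𝕜, E).tangent ∞ (fun y => (⟨y, X y⟩ : TangentBundle 𝓘(𝕜, E) M)) x

/-- The exterior derivative of a `1`-form, with the convention
`dα(A, B) = ½ (A α(B) - B α(A) - α([A, B]))`. It is evaluated on commuting extensions. -/
def extDeriv (α : Π x : M, TangentSpace 𝓘(𝕜, E) x →L[𝕜] 𝕜) (x : M)
    (a b : TangentSpace 𝓘(𝕜, E) x) : 𝕜 :=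
  (1 / 2) * (mvfderiv 𝓘(𝕜, E) (fun y => α y (coordField b y)) x a
    - mvfderiv 𝓘(𝕜, E) (fun y => α y (coordField a y)) x b)

/-- The exterior product of two covectors, with the convention `α ∧ β = ½ (α ⊗ β - β ⊗ α)`. -/
def wedge {x : M} (α β : TangentSpace 𝓘(𝕜, E) x →L[𝕜] 𝕜) (a b : TangentSpace 𝓘(𝕜, E) x) : 𝕜 :=
  (1 / 2) * (α a * β b - α b * β a)

/-- The form `θ ∧ (dθ)ⁿ`, up to a positive constant factor, on `2n + 1` tangent vectors. -/
def contactVolume (n : ℕ) (θ : Π x : M, TangentSpace 𝓘(𝕜, E) x →L[𝕜] 𝕜) (x : M)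
    (w : Fin (2 * n + 1) → TangentSpace 𝓘(𝕜, E) x) : 𝕜 :=
  ∑ s : Equiv.Perm (Fin (2 * n + 1)), ((Equiv.Perm.sign s : ℤ) : 𝕜) *
    (θ x (w (s 0)) * ∏ k : Fin n,
      extDeriv θ x (w (s ⟨2 * k + 1, by omega⟩)) (w (s ⟨2 * k + 2, by omega⟩)))

/-- The Nijenhuis tensor `[G, G](X, Y) = G²[X, Y] + [GX, GY] - G[GX, Y] - G[X, GY]`. -/
def nijenhuis (G : Π x : M, TangentSpace 𝓘(𝕜, E) x →L[𝕜] TangentSpace 𝓘(𝕜, E) x)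
    (X Y : Π x : M, TangentSpace 𝓘(𝕜, E) x) (x : M) : TangentSpace 𝓘(𝕜, E) x :=
  G x (G x (VectorField.mlieBracket 𝓘(𝕜, E) X Y x))
    + VectorField.mlieBracket 𝓘(𝕜, E) (fun y => G y (X y)) (fun y => G y (Y y)) x
    - G x (VectorField.mlieBracket 𝓘(𝕜, E) (fun y => G y (X y)) Y x)
    - G x (VectorField.mlieBracket 𝓘(𝕜, E) X (fun y => G y (Y y)) x)

end Forms

/-! ### Semi-Riemannian metrics and their Levi-Civita connection -/

section Metric

variable {E : Type*} [NormedAddCommGroup E] [NormedSpace ℝ E]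
  {M : Type*} [TopologicalSpace M] [ChartedSpace E M] [IsManifold 𝓘(ℝ, E) ∞ M]

variable (E M) in
/-- A smooth semi-Riemannian metric: a smooth field of nondegenerate symmetric bilinear forms. -/
structure SemiRiemannianMetric where
  inner : Π x : M, TangentSpace 𝓘(ℝ, E) x →L[ℝ] TangentSpace 𝓘(ℝ, E) x →L[ℝ] ℝ
  symm : ∀ (x : M) (a b : TangentSpace 𝓘(ℝ, E) x), inner x a b = inner x b a
  nondegenerate : ∀ (x : M) (a : TangentSpace 𝓘(ℝ, E) x), (∀ b, inner x a b = 0) → a = 0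
  smooth : ContMDiff 𝓘(ℝ, E) (𝓘(ℝ, E).prod 𝓘(ℝ, E →L[ℝ] E →L[ℝ] ℝ)) ∞
    (fun x => Bundle.TotalSpace.mk' (E →L[ℝ] E →L[ℝ] ℝ)
      (E := fun x : M => TangentSpace 𝓘(ℝ, E) x →L[ℝ] TangentSpace 𝓘(ℝ, E) x →L[ℝ] ℝ) x (inner x))

namespace SemiRiemannianMetric

variable (g : SemiRiemannianMetric E M)

/-- The metric at `x` as a bilinear form. -/
def bilin (x : M) : LinearMap.BilinForm ℝ (TangentSpace 𝓘(ℝ, E) x) :=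
  LinearMap.mk₂ ℝ (fun a b => g.inner x a b) (by simp) (by simp) (by simp) (by simp)

/-- The index of the metric at `x`: the maximal dimension of a negative definite subspace. -/
def index (x : M) : ℕ := sigNeg (LinearMap.BilinMap.toQuadraticMap (g.bilin x))

/-- The musical isomorphism `a ↦ g(a, ·)`. -/
def flat [FiniteDimensional ℝ E] (x : M) :
    TangentSpace 𝓘(ℝ, E) x ≃ₗ[ℝ] Module.Dual ℝ (TangentSpace 𝓘(ℝ, E) x) :=
  haveI : FiniteDimensional ℝ (TangentSpace 𝓘(ℝ, E) x) := inferInstanceAs (FiniteDimensional ℝ E)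
  LinearMap.linearEquivOfInjective (g.bilin x)
    (by
      rw [injective_iff_map_eq_zero]
      intro a ha
      exact g.nondegenerate x a fun b => LinearMap.congr_fun ha b)
    Subspace.dual_finrank_eq.symm

/-- The covector field `g(A, ·)` near `x`, in components in the preferred chart at `x`, where `A`
is the extension of `a ∈ T_x M` with constant components. -/
def lowered {x : M} (a : TangentSpace 𝓘(ℝ, E) x) (y : M) : E →L[ℝ] ℝ :=
  (g.inner y (coordField a y)).comp (ofCoords ℝ E x y)

/-- The covector `c ↦ ∂_a g(b, c) + ∂_b g(a, c) - ∂_c g(a, b)` at `x`, where `a`, `b`, `c` are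
extended with constant components in the preferred chart at `x`. -/
def koszul (x : M) (a b : TangentSpace 𝓘(ℝ, E) x) : TangentSpace 𝓘(ℝ, E) x →L[ℝ] ℝ :=
  (mvfderiv 𝓘(ℝ, E) (g.lowered b) x a).comp (coords ℝ E x x)
    + (mvfderiv 𝓘(ℝ, E) (g.lowered a) x b).comp (coords ℝ E x x)
    - mvfderiv 𝓘(ℝ, E) (fun y => g.inner y (coordField a y) (coordField b y)) x

/-- The Christoffel symbol `Γ(a, b)` at `x` in the preferred chart at `x`: the vector with
`2 g(Γ(a, b), c) = ∂_a g(b, c) + ∂_b g(a, c) - ∂_c g(a, b)` for all `c`. -/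
def christoffel [FiniteDimensional ℝ E] (x : M) (a b : TangentSpace 𝓘(ℝ, E) x) :
    TangentSpace 𝓘(ℝ, E) x :=
  (1 / 2 : ℝ) • (g.flat x).symm (g.koszul x a b).toLinearMap

end SemiRiemannianMetric

end Metric

/-! ### Null hypersurfaces -/

section Hypersurface

variable {E : Type*} [NormedAddCommGroup E] [NormedSpace ℝ E]
  {M : Type*} [TopologicalSpace M] [ChartedSpace E M] [IsManifold 𝓘(ℝ, E) ∞ M]
  {F : Type*} [NormedAddCommGroup F] [NormedSpace ℝ F]
  {N : Type*} [TopologicalSpace N] [ChartedSpace F N]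
  (g : SemiRiemannianMetric E M) (f : N → M)

/-- The differential of `f` at `p`. -/
abbrev diff (f : N → M) (p : N) : TangentSpace 𝓘(ℝ, F) p →L[ℝ] TangentSpace 𝓘(ℝ, E) (f p) :=
  mfderiv 𝓘(ℝ, F) 𝓘(ℝ, E) f p

/-- The Levi-Civita derivative of `g`, for a vector field `Y` along `f`, in the direction
`w ∈ T_p N`: in the chart at `f p` its components are `w(Yᵏ) + Γᵏ(df w, Y)`. -/
def covDeriv [FiniteDimensional ℝ E] (Y : Π p : N, TangentSpace 𝓘(ℝ, E) (f p)) (p : N)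
    (w : TangentSpace 𝓘(ℝ, F) p) : TangentSpace 𝓘(ℝ, E) (f p) :=
  ofCoords ℝ E (f p) (f p) (mvfderiv 𝓘(ℝ, F) (fun q => coords ℝ E (f p) (f q) (Y q)) p w)
    + g.christoffel (f p) (diff f p w) (Y p)

/-- The tensor induced by the metric on `T_p N`. -/
def inducedForm (p : N) : LinearMap.BilinForm ℝ (TangentSpace 𝓘(ℝ, F) p) :=
  (g.bilin (f p)).compl₁₂ (diff f p).toLinearMap (diff f p).toLinearMap

variable (F)

/-- The normal space: all ambient vectors at `f p` orthogonal to the tangent space of `N`. -/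
def normalSpace (p : N) : Submodule ℝ (TangentSpace 𝓘(ℝ, E) (f p)) where
  carrier := {a | ∀ w : TangentSpace 𝓘(ℝ, F) p, g.inner (f p) (diff f p w) a = 0}
  add_mem' ha hb w := by rw [map_add, ha w, hb w, add_zero]
  zero_mem' w := map_zero _
  smul_mem' c a ha w := by rw [map_smul, ha w, smul_zero]

/-- The normal vectors that are tangent to `N`, as vectors of `T_p N`. For a null hypersurface
these are all normal vectors. -/
def radical (p : N) : Submodule ℝ (TangentSpace 𝓘(ℝ, F) p) :=
  (normalSpace F g f p).comap (diff f p).toLinearMap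

/-- `f : N → M` is a null hypersurface: a smooth immersion of codimension one, such that the
induced tensor has constant rank `dim N - 1` and the normal spaces are lines. -/
structure IsNullHypersurface [IsManifold 𝓘(ℝ, F) ∞ N] : Prop where
  smooth : ContMDiff 𝓘(ℝ, F) 𝓘(ℝ, E) ∞ f
  immersion : ∀ p, Function.Injective (diff (E := E) (F := F) f p)
  codim : Module.finrank ℝ F + 1 = Module.finrank ℝ E
  rank : ∀ p, Module.finrank ℝ (LinearMap.range (inducedForm (F := F) g f p)) + 1 = Module.finrank ℝ F
  rank_normal : ∀ p, Module.finrank ℝ (normalSpace F g f p) = 1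

variable [IsManifold 𝓘(ℝ, F) ∞ N]

/-- A screen distribution: a smooth distribution on `N` complementary to the normal one. -/
structure ScreenDistribution where
  space : Π p : N, Submodule ℝ (TangentSpace 𝓘(ℝ, F) p)
  isCompl : ∀ p, IsCompl (space p) (radical F g f p)
  smooth : ∀ p, ∀ w ∈ space p, ∃ Z : Π q : N, TangentSpace 𝓘(ℝ, F) q,
    SmoothFieldAt Z p ∧ (∀ᶠ q in 𝓝 p, Z q ∈ space q) ∧ Z p = w

variable {F g f}

/-- The projection of `TN` onto the screen distribution along the normal distribution. -/
def ScreenDistribution.proj (S : ScreenDistribution F g f) (Y : Π p : N, TangentSpace 𝓘(ℝ, F) p)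
    (p : N) : TangentSpace 𝓘(ℝ, F) p :=
  (S.space p).projection (radical F g f p) (S.isCompl p) (Y p)

variable (g f)

/-- On the open set `W`, `ξ` is a smooth nowhere zero section of the normal distribution and `η`
is the corresponding smooth section of the null transversal bundle of the screen `S`. -/
structure IsNullFrame (S : ScreenDistribution F g f) (W : Set N)
    (ξ : Π p : N, TangentSpace 𝓘(ℝ, F) p) (η : Π p : N, TangentSpace 𝓘(ℝ, E) (f p)) : Prop where
  isOpen : IsOpen W
  smooth_normal : ∀ p ∈ W, SmoothFieldAt ξ p
  smooth_transversal : ContMDiffOn 𝓘(ℝ, F) 𝓘(ℝ, E).tangent ∞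
    (fun p => (⟨f p, η p⟩ : TangentBundle 𝓘(ℝ, E) M)) W
  mem_radical : ∀ p ∈ W, ξ p ∈ radical F g f p
  ne_zero : ∀ p ∈ W, ξ p ≠ 0
  pairing : ∀ p ∈ W, g.inner (f p) (diff f p (ξ p)) (η p) = 1
  null : ∀ p ∈ W, g.inner (f p) (η p) (η p) = 0
  orthogonal : ∀ p ∈ W, ∀ z ∈ S.space p, g.inner (f p) (η p) (diff f p z) = 0

variable [FiniteDimensional ℝ E]

/-- The local second fundamental form `B` of `N`: the coefficient `g(∇̄_X Y, ξ)` of the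
transversal vector in the Gauss formula `∇̄_X Y = ∇_X Y + B(X, Y) η`. -/
def secondForm (ξ X Y : Π p : N, TangentSpace 𝓘(ℝ, F) p) (p : N) : ℝ :=
  g.inner (f p) (covDeriv g f (fun q => diff f q (Y q)) p (X p)) (diff f p (ξ p))

/-- The induced connection `∇_X Y = ∇̄_X Y - B(X, Y) η` of `N`, as an ambient vector. -/
def inducedConnection (ξ : Π p : N, TangentSpace 𝓘(ℝ, F) p)
    (η : Π p : N, TangentSpace 𝓘(ℝ, E) (f p)) (X Y : Π p : N, TangentSpace 𝓘(ℝ, F) p) (p : N) :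
    TangentSpace 𝓘(ℝ, E) (f p) :=
  covDeriv g f (fun q => diff f q (Y q)) p (X p) - secondForm g f ξ X Y p • η p

/-- The local second fundamental form `C` of the screen distribution: for a section `Z` of the
screen, the coefficient `g(∇_X Z, η)` of `ξ` in the Gauss formula `∇_X Z = ∇*_X Z + C(X, Z) ξ`. -/
def screenForm (ξ : Π p : N, TangentSpace 𝓘(ℝ, F) p) (η : Π p : N, TangentSpace 𝓘(ℝ, E) (f p))
    (X Z : Π p : N, TangentSpace 𝓘(ℝ, F) p) (p : N) : ℝ :=
  g.inner (f p) (inducedConnection g f ξ η X Z p) (η p)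

variable {g f}

namespace ScreenDistribution

variable (S : ScreenDistribution F g f)

/-- Totally umbilic: locally `B(X, PY) = ρ g(X, Y)` with a smooth function `ρ`. -/
def TotallyUmbilic : Prop :=
  ∀ p₀ : N, ∃ (W : Set N) (ξ : Π p : N, TangentSpace 𝓘(ℝ, F) p)
    (η : Π p : N, TangentSpace 𝓘(ℝ, E) (f p)) (ρ : N → ℝ),
    p₀ ∈ W ∧ IsNullFrame g f S W ξ η ∧ ContMDiffOn 𝓘(ℝ, F) 𝓘(ℝ, ℝ) ∞ ρ W ∧
    ∀ p ∈ W, ∀ X Y : Π p : N, TangentSpace 𝓘(ℝ, F) p, SmoothFieldAt X p → SmoothFieldAt Y p →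
      secondForm g f ξ X (S.proj Y) p = ρ p * inducedForm g f p (X p) (Y p)

/-- Screen totally umbilic: locally `C(X, PY) = ρ g(X, Y)` with a smooth function `ρ`. -/
def ScreenTotallyUmbilic : Prop :=
  ∀ p₀ : N, ∃ (W : Set N) (ξ : Π p : N, TangentSpace 𝓘(ℝ, F) p)
    (η : Π p : N, TangentSpace 𝓘(ℝ, E) (f p)) (ρ : N → ℝ),
    p₀ ∈ W ∧ IsNullFrame g f S W ξ η ∧ ContMDiffOn 𝓘(ℝ, F) 𝓘(ℝ, ℝ) ∞ ρ W ∧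
    ∀ p ∈ W, ∀ X Y : Π p : N, TangentSpace 𝓘(ℝ, F) p, SmoothFieldAt X p → SmoothFieldAt Y p →
      screenForm g f ξ η X (S.proj Y) p = ρ p * inducedForm g f p (X p) (Y p)

/-- Screen (locally) conformal: locally `C(X, PY) = ψ B(X, Y)` with a nowhere zero smooth
function `ψ`. -/
def ScreenConformal : Prop :=
  ∀ p₀ : N, ∃ (W : Set N) (ξ : Π p : N, TangentSpace 𝓘(ℝ, F) p)
    (η : Π p : N, TangentSpace 𝓘(ℝ, E) (f p)) (ψ : N → ℝ),
    p₀ ∈ W ∧ IsNullFrame g f S W ξ η ∧ ContMDiffOn 𝓘(ℝ, F) 𝓘(ℝ, ℝ) ∞ ψ W ∧ (∀ p ∈ W, ψ p ≠ 0) ∧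
    ∀ p ∈ W, ∀ X Y : Π p : N, TangentSpace 𝓘(ℝ, F) p, SmoothFieldAt X p → SmoothFieldAt Y p →
      screenForm g f ξ η X (S.proj Y) p = ψ p * secondForm g f ξ X Y p

end ScreenDistribution

end Hypersurface

/-! ### Complex contact metric structures -/

section ComplexContact

variable {E : Type*} [NormedAddCommGroup E] [NormedSpace ℂ E]
  {M : Type*} [TopologicalSpace M] [ChartedSpace E M] [IsManifold 𝓘(ℂ, E) ∞ M]

/-- The real manifold underlying a complex manifold. -/
instance realManifold : IsManifold 𝓘(ℝ, E) ∞ M := by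
  apply isManifold_of_contDiffOn
  intro e e' he he'
  have h := (contDiffGroupoid ∞ 𝓘(ℂ, E)).compatible he he'
  rw [contDiffGroupoid, mem_groupoid_of_pregroupoid] at h
  exact h.1.restrict_scalars ℝ

/-- The complex structure `J`: multiplication by `i` in a holomorphic chart. -/
def J (x : M) : TangentSpace 𝓘(ℝ, E) x →L[ℝ] TangentSpace 𝓘(ℝ, E) x :=
  (ofCoords ℝ E x x).comp
    ((Complex.I • ContinuousLinearMap.id ℝ E : E →L[ℝ] E).comp (coords ℝ E x x))

/-- The canonical identification of the real tangent space with the holomorphic one. -/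
def toHolomorphic (x : M) (a : TangentSpace 𝓘(ℝ, E) x) : TangentSpace 𝓘(ℂ, E) x :=
  ofCoords ℂ E x x (coords ℝ E x x a)

/-- Local tensors of a complex contact metric structure: `1`-forms `u` and `σ`, a vector field `U`
and a `(1, 1)`-tensor `G`. They are meaningful on an open set only. -/
structure LocalTensors (E : Type*) [NormedAddCommGroup E] [NormedSpace ℂ E]
    (M : Type*) [TopologicalSpace M] [ChartedSpace E M] where
  u : Π x : M, TangentSpace 𝓘(ℝ, E) x →L[ℝ] ℝ
  U : Π x : M, TangentSpace 𝓘(ℝ, E) x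
  G : Π x : M, TangentSpace 𝓘(ℝ, E) x →L[ℝ] TangentSpace 𝓘(ℝ, E) x
  σ : Π x : M, TangentSpace 𝓘(ℝ, E) x →L[ℝ] ℝ

namespace LocalTensors

variable (t : LocalTensors E M)

/-- `v = u ∘ J`. -/
def v (x : M) : TangentSpace 𝓘(ℝ, E) x →L[ℝ] ℝ := (t.u x).comp (J x)

/-- `V = -J U`. -/
def V (x : M) : TangentSpace 𝓘(ℝ, E) x := -J x (t.U x)

/-- `H = G J`. -/
def H (x : M) : TangentSpace 𝓘(ℝ, E) x →L[ℝ] TangentSpace 𝓘(ℝ, E) x := (t.G x).comp (J x)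

/-- The tensors `u`, `U`, `G`, `σ` are smooth on `O`. -/
structure SmoothOn (O : Set M) : Prop where
  u : ContMDiffOn 𝓘(ℝ, E) (𝓘(ℝ, E).prod 𝓘(ℝ, E →L[ℝ] ℝ)) ∞
    (fun x => Bundle.TotalSpace.mk' (E →L[ℝ] ℝ)
      (E := fun x : M => TangentSpace 𝓘(ℝ, E) x →L[ℝ] ℝ) x (t.u x)) O
  U : ∀ x ∈ O, SmoothFieldAt t.U x
  G : ContMDiffOn 𝓘(ℝ, E) (𝓘(ℝ, E).prod 𝓘(ℝ, E →L[ℝ] E)) ∞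
    (fun x => Bundle.TotalSpace.mk' (E →L[ℝ] E)
      (E := fun x : M => TangentSpace 𝓘(ℝ, E) x →L[ℝ] TangentSpace 𝓘(ℝ, E) x) x (t.G x)) O
  σ : ContMDiffOn 𝓘(ℝ, E) (𝓘(ℝ, E).prod 𝓘(ℝ, E →L[ℝ] ℝ)) ∞
    (fun x => Bundle.TotalSpace.mk' (E →L[ℝ] ℝ)
      (E := fun x : M => TangentSpace 𝓘(ℝ, E) x →L[ℝ] ℝ) x (t.σ x)) O

/-- The identities of a complex almost contact metric structure and of a complex contact metric
structure at `x`. -/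
structure Laws (g : SemiRiemannianMetric E M) (x : M) : Prop where
  G_sq : ∀ a, t.G x (t.G x a) = -a + t.u x a • t.U x + t.v x a • t.V x
  H_sq : ∀ a, t.H x (t.H x a) = -a + t.u x a • t.U x + t.v x a • t.V x
  G_skew : ∀ a b, g.inner x (t.G x a) b = -g.inner x a (t.G x b)
  dual : ∀ a, g.inner x (t.U x) a = t.u x a
  G_J : ∀ a, t.G x (J x a) = -J x (t.G x a)
  G_U : t.G x (t.U x) = 0
  u_U : t.u x (t.U x) = 1
  ext_u : ∀ a b, extDeriv t.u x a b = g.inner x a (t.G x b) + wedge (t.σ x) (t.v x) a b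
  ext_v : ∀ a b, extDeriv t.v x a b = g.inner x a (t.H x b) - wedge (t.σ x) (t.u x) a b

/-- The tensor `S` of the definition of normality. -/
def S (g : SemiRiemannianMetric E M) (X Y : Π x : M, TangentSpace 𝓘(ℝ, E) x) (x : M) :
    TangentSpace 𝓘(ℝ, E) x :=
  nijenhuis t.G X Y x
    + (2 * g.inner x (X x) (t.G x (Y x))) • t.U x - (2 * g.inner x (X x) (t.H x (Y x))) • t.V x
    + (2 : ℝ) • (t.v x (Y x) • t.H x (X x) - t.v x (X x) • t.H x (Y x))
    + t.σ x (t.G x (Y x)) • t.H x (X x) - t.σ x (t.G x (X x)) • t.H x (Y x)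
    + t.σ x (X x) • t.G x (t.H x (Y x)) - t.σ x (Y x) • t.G x (t.H x (X x))

/-- The tensor `T` of the definition of normality. -/
def T (g : SemiRiemannianMetric E M) (X Y : Π x : M, TangentSpace 𝓘(ℝ, E) x) (x : M) :
    TangentSpace 𝓘(ℝ, E) x :=
  nijenhuis t.H X Y x
    - (2 * g.inner x (X x) (t.G x (Y x))) • t.U x + (2 * g.inner x (X x) (t.H x (Y x))) • t.V x
    + (2 : ℝ) • (t.u x (Y x) • t.G x (X x) - t.u x (X x) • t.G x (Y x))
    + t.σ x (t.H x (X x)) • t.G x (Y x) - t.σ x (t.H x (Y x)) • t.G x (X x)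
    + t.σ x (X x) • t.G x (t.H x (Y x)) - t.σ x (Y x) • t.G x (t.H x (X x))

/-- The vector field `X` is, near `x`, a section of the horizontal subbundle `u = v = 0`. -/
def HorizontalNear (X : Π x : M, TangentSpace 𝓘(ℝ, E) x) (x : M) : Prop :=
  ∀ᶠ y in 𝓝 x, t.u y (X y) = 0 ∧ t.v y (X y) = 0

end LocalTensors

/-- A complex contact structure on a complex manifold of dimension `2n + 1`: an open cover with
holomorphic `1`-forms `θ` such that `θ ∧ (dθ)ⁿ` vanishes nowhere, which on overlaps differ by
nowhere zero holomorphic factors. -/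
structure ComplexContactStructure (n : ℕ) (A : Type*) (E : Type*) [NormedAddCommGroup E]
    [NormedSpace ℂ E] (M : Type*) [TopologicalSpace M] [ChartedSpace E M]
    [IsManifold 𝓘(ℂ, E) ∞ M] where
  dim : Module.finrank ℂ E = 2 * n + 1
  O : A → Set M
  isOpen : ∀ i, IsOpen (O i)
  cover : ∀ x, ∃ i, x ∈ O i
  θ : A → Π x : M, TangentSpace 𝓘(ℂ, E) x →L[ℂ] ℂ
  holomorphic : ∀ i, ContMDiffOn 𝓘(ℂ, E) (𝓘(ℂ, E).prod 𝓘(ℂ, E →L[ℂ] ℂ)) ∞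
    (fun x => Bundle.TotalSpace.mk' (E →L[ℂ] ℂ)
      (E := fun x : M => TangentSpace 𝓘(ℂ, E) x →L[ℂ] ℂ) x (θ i x)) (O i)
  contact : ∀ i, ∀ x ∈ O i, ∃ w, contactVolume n (θ i) x w ≠ 0
  overlap : ∀ i j, ∃ c : M → ℂ, ContMDiffOn 𝓘(ℂ, E) 𝓘(ℂ, ℂ) ∞ c (O i ∩ O j) ∧
    ∀ x ∈ O i ∩ O j, c x ≠ 0 ∧ θ i x = c x • θ j x

/-- A complex contact metric structure: a complex contact structure with a Hermitian
semi-Riemannian metric and local tensors that satisfy the identities above, whose forms `u - iv`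
are nowhere zero multiples of the contact forms, and which on overlaps differ by a rotation. -/
structure ComplexContactMetricStructure (n : ℕ) (A : Type*) (E : Type*) [NormedAddCommGroup E]
    [NormedSpace ℂ E] (M : Type*) [TopologicalSpace M] [ChartedSpace E M]
    [IsManifold 𝓘(ℂ, E) ∞ M] extends ComplexContactStructure n A E M where
  g : SemiRiemannianMetric E M
  hermitian : ∀ x a b, g.inner x (J x a) (J x b) = g.inner x a b
  t : A → LocalTensors E M
  smooth : ∀ i, (t i).SmoothOn (O i)
  laws : ∀ i, ∀ x ∈ O i, (t i).Laws g x
  compatible : ∀ i, ∃ c : M → ℂ, ∀ x ∈ O i, c x ≠ 0 ∧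
    ∀ a, θ i x (toHolomorphic x a) = c x * ((t i).u x a - Complex.I * (t i).v x a)
  rotation : ∀ i j, ∃ a b : M → ℝ, ∀ x ∈ O i ∩ O j, a x ^ 2 + b x ^ 2 = 1 ∧
    (t j).u x = a x • (t i).u x - b x • (t i).v x ∧
    (t j).v x = b x • (t i).u x + a x • (t i).v x ∧
    (t j).G x = a x • (t i).G x - b x • (t i).H x ∧
    (t j).H x = b x • (t i).G x + a x • (t i).H x

namespace ComplexContactMetricStructure

variable {n : ℕ} {A : Type*} (K : ComplexContactMetricStructure n A E M)

/-- Normality: `S(X, Y) = T(X, Y) = 0` for horizontal `X`, `Y`, and `S(U, X) = T(V, X) = 0` for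
all `X`. -/
def IsNormal : Prop :=
  ∀ i, ∀ x ∈ K.O i,
    (∀ X Y : Π x : M, TangentSpace 𝓘(ℝ, E) x, SmoothFieldAt X x → SmoothFieldAt Y x →
      (K.t i).HorizontalNear X x → (K.t i).HorizontalNear Y x →
        (K.t i).S K.g X Y x = 0 ∧ (K.t i).T K.g X Y x = 0) ∧
    (∀ X : Π x : M, TangentSpace 𝓘(ℝ, E) x, SmoothFieldAt X x →
      (K.t i).S K.g (K.t i).U X x = 0 ∧ (K.t i).T K.g (K.t i).V X x = 0)

/-- The characteristic subbundle: its fibre at `x` is spanned by `U` and `V`, for any member of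
the cover that contains `x`. -/
def characteristic (x : M) : Submodule ℝ (TangentSpace 𝓘(ℝ, E) x) :=
  ⨆ (i : A) (_ : x ∈ K.O i), Submodule.span ℝ {(K.t i).U x, (K.t i).V x}

end ComplexContactMetricStructure

end ComplexContact

end ComplexContact
end

/-!
The heart of the matter is the identity `g(∇̄_a U, b) = -g(G a, b)` for horizontal vectors `a`, `b`
of a normal indefinite complex contact metric manifold (`LocalTensors.inner_covDeriv_U`). As
`u = g(U, ·)`, the skew-symmetric part of `∇̄U` is `du`, which on horizontal vectors is
`g(a, G b)`. The symmetric part is half of the Lie derivative `L_U g`, and this vanishes on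
horizontal vectors: `d(du) = 0` and the formulas for `du` and `dv` compute `L_U` of the form
`g(·, G ·)`, while the equation `S(U, ·) = 0` computes `L_U G`, and the two together leave
`(L_U g)(a, G b) = 0`. This computation is done in one chart (`covDeriv_killing_in_chart`).
It needs `du` at all points of that chart, hence the comparison of exterior derivatives in different
charts (`extDeriv_eq_fderiv_inChart`).

Let now `M` be a null hypersurface with `U`, `V` tangent to it, `ξ` a normal field and `η` the
transversal one. Suppose that a horizontal vector `Z` satisfies `g(∇̄_w U, Z) = 0` for all
horizontal tangent vectors `w`. By the identity, `G Z` is orthogonal to those `w`, and it is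
orthogonal to `U` and `V`; so it is normal to `M` and `G Z = c ξ` (`exists_G_eq_smul`). On horizontal
vectors `G` is skew-adjoint with `G² = -1`.

* If `M` is totally umbilic, this applies to `Z = ξ`, since `B(w, U) = g(∇̄_w U, ξ)`. Then
  `-ξ = G² ξ = c² ξ`, which is impossible.
* If the screen contains `U` and `V`, then `C(w, U) = g(∇̄_w U, η)`, and `η` is horizontal. If `M` is
  screen totally umbilic, `Z = η` is allowed; if `M` is screen conformal, `Z = η - ψ ξ` is. In both
  cases `Z = -G² Z = -c G ξ` is orthogonal to `ξ`, but `g(Z, ξ) = 1`.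
-/

set_option linter.unusedSectionVars false

noncomputable section

namespace ComplexContact

/-! ### The derivative of the characteristic field in a chart -/

section LinearModel

variable {E : Type*} [NormedAddCommGroup E] [NormedSpace ℝ E]

/-- On an open subset of a vector space, the tensors of a complex contact metric structure with
`S(U, ·) = 0` satisfy `g(∇_a U, b) = -g(G a, b)` for horizontal `a`, `b`. Here `J` is constant, and
the left side is the Levi-Civita derivative written out with the Koszul formula. The constants
come from `du = ½ (∂_a u_b - ∂_b u_a)`.

Since `u = g(U, ·)`, the skew part of `∇U` is `du`, which is `g(a, G b)` on horizontal vectors.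
The symmetric part is half of `L_U g`, which is shown to vanish on them. -/
theorem covDeriv_killing_in_chart {o : E} {u σ : E → E →L[ℝ] ℝ} {U : E → E} {G : E → E →L[ℝ] E}
    {J : E →L[ℝ] E} {g : E → E →L[ℝ] E →L[ℝ] ℝ}
    (hu : ContDiffAt ℝ 2 u o) (hσ : DifferentiableAt ℝ σ o) (hU : DifferentiableAt ℝ U o)
    (hG : DifferentiableAt ℝ G o) (hg : DifferentiableAt ℝ g o)
    (symm : ∀ᶠ p in 𝓝 o, ∀ a b, g p a b = g p b a)
    (skew : ∀ᶠ p in 𝓝 o, ∀ a b, g p (G p a) b = -g p a (G p b))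
    (dual : ∀ᶠ p in 𝓝 o, ∀ a, g p (U p) a = u p a)
    (G_U : ∀ᶠ p in 𝓝 o, G p (U p) = 0)
    (u_U : u o (U o) = 1)
    (u_JU : ∀ᶠ p in 𝓝 o, u p (J (U p)) = 0)
    (ext_u : ∀ᶠ p in 𝓝 o, ∀ a b, fderiv ℝ u p a b - fderiv ℝ u p b a
      = 2 * g p a (G p b) + (σ p a * u p (J b) - σ p b * u p (J a)))
    (ext_v : ∀ a b, fderiv ℝ u o a (J b) - fderiv ℝ u o b (J a)
      = 2 * g o a (G o (J b)) - (σ o a * u o b - σ o b * u o a))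
    (G_sq : ∀ a, G o (G o a) = -a + u o a • U o - u o (J a) • J (U o))
    (G_J : ∀ a, G o (J a) = -J (G o a))
    (normal : ∀ c, -G o (G o (fderiv ℝ U o c))
      - G o (fderiv ℝ G o (U o) c - fderiv ℝ U o (G o c)) + σ o (U o) • G o (G o (J c)) = 0)
    {a b : E} (ha : u o a = 0) (ha' : u o (J a) = 0) (hb : u o b = 0) (hb' : u o (J b) = 0) :
    g o (fderiv ℝ U o a) b
      + (1 / 2) * (fderiv ℝ g o a (U o) b + fderiv ℝ g o (U o) a b - fderiv ℝ g o b a (U o))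
      = -g o (G o a) b := by
  have hU' := hU.hasFDerivAt
  have hG' := hG.hasFDerivAt
  have hg' := hg.hasFDerivAt
  have hσ' := hσ.hasFDerivAt
  have hu' := (hu.differentiableAt (by norm_num)).hasFDerivAt
  have hL : HasFDerivAt (fderiv ℝ u) (fderiv ℝ (fderiv ℝ u) o) o :=
    ((hu.fderiv_right (m := 1) (by norm_num)).differentiableAt (by norm_num)).hasFDerivAt
  have hsymm : ∀ a b, fderiv ℝ (fderiv ℝ u) o a b = fderiv ℝ (fderiv ℝ u) o b a :=
    hu.isSymmSndFDerivAt (by simp)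
  -- values at `o`
  have symm0 := symm.self_of_nhds
  have skew0 := skew.self_of_nhds
  have dual0 := dual.self_of_nhds
  have G_U0 := G_U.self_of_nhds
  have u_JU0 := u_JU.self_of_nhds
  have ext_u0 := ext_u.self_of_nhds
  set A := fderiv ℝ U o with hA
  set Go := G o with hGo
  set go := g o with hgo
  set Uo := U o with hUo
  set uo := u o with huo
  set σo := σ o with hσo
  have uG : ∀ c, uo (Go c) = 0 := fun c => by
    rw [← dual0, symm0, skew0, G_U0]; simp
  have uJG : ∀ c, uo (J (Go c)) = 0 := fun c => by
    have := uG (J c)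
    rw [G_J] at this; simpa using this
  have GJU : Go (J Uo) = 0 := by rw [G_J, G_U0]; simp
  -- derivative of `g(U, b) = u(b)`
  have d_dual : ∀ a b, fderiv ℝ g o a Uo b + go (A a) b = fderiv ℝ u o a b := by
    intro a b
    have h1 := (hg'.clm_apply hU').clm_apply (hasFDerivAt_const b o)
    have h2 := hu'.clm_apply (hasFDerivAt_const b o)
    have h3 := (h1.congr_of_eventuallyEq
      (dual.mono fun p hp => (hp b).symm : (fun p => u p b) =ᶠ[𝓝 o] _)).unique h2
    have h4 := DFunLike.congr_fun h3 a
    simpa [add_comm] using h4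
  have d_JU : ∀ a, fderiv ℝ u o a (J Uo) + uo (J (A a)) = 0 := by
    intro a
    have h1 := hu'.clm_apply (J.hasFDerivAt.comp o hU')
    have h3 := ((hasFDerivAt_const (0 : ℝ) o).congr_of_eventuallyEq u_JU).unique h1
    have h4 := DFunLike.congr_fun h3 a
    simp at h4
    linarith
  -- derivative of the formula for `du` in the direction `U`
  have d_ext : ∀ a b, fderiv ℝ (fderiv ℝ u) o Uo a b - fderiv ℝ (fderiv ℝ u) o Uo b a
      = 2 * (fderiv ℝ g o Uo a (Go b) + go a (fderiv ℝ G o Uo b))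
        + (fderiv ℝ σ o Uo a * uo (J b) + σo a * fderiv ℝ u o Uo (J b)
          - fderiv ℝ σ o Uo b * uo (J a) - σo b * fderiv ℝ u o Uo (J a)) := by
    intro a b
    have ca := hasFDerivAt_const (𝕜 := ℝ) a o
    have cb := hasFDerivAt_const (𝕜 := ℝ) b o
    have h1 := ((hL.clm_apply ca).clm_apply cb).sub ((hL.clm_apply cb).clm_apply ca)
    have h2 := (((hg'.clm_apply ca).clm_apply (hG'.clm_apply cb)).const_mul 2).add
      (((hσ'.clm_apply ca).mul (hu'.clm_apply (hasFDerivAt_const (J b) o))).sub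
        ((hσ'.clm_apply cb).mul (hu'.clm_apply (hasFDerivAt_const (J a) o))))
    have h3 := (h2.congr_of_eventuallyEq (ext_u.mono fun p hp => hp a b :
      ((fun p => fderiv ℝ u p a b) - fun p => fderiv ℝ u p b a) =ᶠ[𝓝 o] _)).unique h1
    have h4 := DFunLike.congr_fun h3 Uo
    simp at h4
    linear_combination -h4
  -- derivative of `2 du(U, b) = σ(U) v(b)`, in a direction `a` and for `v(b) = 0` at `o`;
  -- together with `d_ext` this replaces `d(du)(U, a, b) = 0`
  have d_int : ∀ a b, uo (J b) = 0 → fderiv ℝ (fderiv ℝ u) o a Uo b + fderiv ℝ u o (A a) b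
      - fderiv ℝ (fderiv ℝ u) o a b Uo - fderiv ℝ u o b (A a)
      = σo Uo * fderiv ℝ u o a (J b) := by
    intro a b hb
    have cb := hasFDerivAt_const (𝕜 := ℝ) b o
    have h1 := ((hL.clm_apply hU').clm_apply cb).sub ((hL.clm_apply cb).clm_apply hU')
    have h2 := (hσ'.clm_apply hU').mul (hu'.clm_apply (hasFDerivAt_const (J b) o))
    have h3 := (h2.congr_of_eventuallyEq (by
      filter_upwards [ext_u, skew, G_U, u_JU] with p h1 h2 h3 h4
      have := h1 (U p) b
      rw [h4] at this
      have h5 := h2 (U p) b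
      rw [h3] at h5
      simp at h5 ⊢
      rw [this]
      linarith :
      ((fun p => fderiv ℝ u p (U p) b) - fun p => fderiv ℝ u p b (U p)) =ᶠ[𝓝 o] _)).unique h1
    have h4 := DFunLike.congr_fun h3 a
    simp [← huo, hb] at h4
    linear_combination -h4
  -- the normality equation is `G` applied to a formula for `L_U G`; it determines `L_U G` up to
  -- the kernel of `G`, which is spanned by `U` and `J U` and orthogonal to horizontal vectors
  have lieG : ∀ a c, uo a = 0 → uo (J a) = 0 →
      go a (fderiv ℝ G o Uo c) = go a (A (Go c)) - go a (Go (A c)) + σo Uo * go a (Go (J c)) := by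
    intro a c ha ha'
    have hJU : go a (J Uo) = 0 := by
      -- `a = -G² a`, and `G J U = 0`
      have h := G_sq a
      rw [ha, ha'] at h
      have : a = -Go (Go a) := by rw [h]; simp
      rw [this]
      simp [skew0, GJU]
    have h : ∀ z, Go z = 0 → go a z = 0 := by
      intro z hz
      have h := G_sq z
      rw [hz, map_zero] at h
      have hz' : z = uo z • Uo - uo (J z) • J Uo := by
        rw [eq_comm, sub_eq_add_neg, add_assoc, neg_add_eq_zero] at h
        rw [sub_eq_add_neg]
        exact h
      rw [hz']
      simp [hJU, symm0 a Uo, dual0, ha]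
    have := h (-Go (A c) - (fderiv ℝ G o Uo c - A (Go c)) + σo Uo • Go (J c)) (by
      rw [← normal c]; simp)
    simp at this
    linarith
  -- `(L_U g)(a, G b) = 0` for horizontal `a`, `b`
  have killing : ∀ a b, uo a = 0 → uo (J a) = 0 → uo b = 0 → uo (J b) = 0 →
      fderiv ℝ g o Uo a (Go b) + go (A a) (Go b) + go a (A (Go b)) = 0 := by
    intro a b ha ha' hb hb'
    have e1 := d_ext a b
    have e2 := d_int a b hb'
    have e3 := d_int b a ha'
    have e4 := ext_v a b
    have e5 := ext_u0 (A a) b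
    have e6 := ext_u0 (A b) a
    have e7 := lieG a b ha ha'
    have e8 := ext_v Uo b
    have e9 := ext_v Uo a
    have e10 := d_JU a
    have e11 := d_JU b
    have e12 : go Uo (Go (J b)) = 0 := by rw [dual0, uG]
    have e13 : go Uo (Go (J a)) = 0 := by rw [dual0, uG]
    have e14 : go (A b) (Go a) = -go a (Go (A b)) := by rw [symm0, skew0]
    have e15 := hsymm Uo a
    have e16 := hsymm Uo b
    have e17 := hsymm a b
    rw [e15, e16] at e1
    rw [e17] at e2
    rw [ha', hb'] at e1
    rw [hb'] at e5
    rw [ha'] at e6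
    rw [ha, hb] at e4
    rw [hb, u_U] at e8
    rw [ha, u_U] at e9
    have f1 : fderiv ℝ u o Uo (J b) = σo b - uo (J (A b)) := by linarith
    have f2 : fderiv ℝ u o Uo (J a) = σo a - uo (J (A a)) := by linarith
    rw [f1, f2] at e1
    linear_combination (-1/2) * e1 + (1/2) * e2 - (1/2) * e3 + (1/2) * σo Uo * e4
      - (1/2) * e5 + (1/2) * e6 - e7 + e14
  -- on horizontal vectors `G` is invertible, with inverse `-G`
  have hbb : b = Go (-Go b) := by
    have h := G_sq b
    rw [hb, hb'] at h
    rw [map_neg, h]; simp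
  have k := killing a (-Go b) ha ha' (by simp [uG]) (by simp [uJG])
  rw [← hbb] at k
  have e1 := d_dual a b
  have e2 := d_dual b a
  have e3 := ext_u0 a b
  have e4 : fderiv ℝ g o b a Uo = fderiv ℝ g o b Uo a := by
    have h1 := ((hg'.clm_apply (hasFDerivAt_const a o)).clm_apply (hasFDerivAt_const Uo o))
    have h2 := ((hg'.clm_apply (hasFDerivAt_const Uo o)).clm_apply (hasFDerivAt_const a o))
    have h3 := (h2.congr_of_eventuallyEq (symm.mono fun p hp => hp a Uo :
      (fun p => g p a Uo) =ᶠ[𝓝 o] _)).unique h1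
    have h4 := DFunLike.congr_fun h3 b
    simpa using h4.symm
  rw [ha', hb'] at e3
  rw [e4, skew0, symm0 a (A b)] at *
  linarith

end LinearModel

/-! ### Vector fields and functions in the preferred charts -/

section Coordinates

variable {𝕜 : Type*} [RCLike 𝕜] {E : Type*} [NormedAddCommGroup E] [NormedSpace 𝕜 E]
  {M : Type*} [TopologicalSpace M] [ChartedSpace E M] [IsManifold 𝓘(𝕜, E) ∞ M]

theorem ofCoords_coords {x y : M} (hy : y ∈ (chartAt E x).source) (a : TangentSpace 𝓘(𝕜, E) y) :
    ofCoords 𝕜 E x y (coords 𝕜 E x y a) = a :=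
  (trivializationAt E (TangentSpace 𝓘(𝕜, E) : M → Type _) x).symmL_continuousLinearMapAt
    (by simpa using hy) a

theorem coords_ofCoords {x y : M} (hy : y ∈ (chartAt E x).source) (a : E) :
    coords 𝕜 E x y (ofCoords 𝕜 E x y a) = a :=
  (trivializationAt E (TangentSpace 𝓘(𝕜, E) : M → Type _) x).continuousLinearMapAt_symmL
    (by simpa using hy) a

theorem coords_eq_tangentCoordChange {x y : M} (hy : y ∈ (chartAt E x).source) :
    coords 𝕜 E x y = tangentCoordChange 𝓘(𝕜, E) y x y :=
  TangentBundle.continuousLinearMapAt_trivializationAt_eq_core hy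

theorem ofCoords_eq_tangentCoordChange {x y : M} (hy : y ∈ (chartAt E x).source) :
    ofCoords 𝕜 E x y = tangentCoordChange 𝓘(𝕜, E) x y y :=
  TangentBundle.symmL_trivializationAt_eq_core hy

theorem coords_self (x : M) (a : TangentSpace 𝓘(𝕜, E) x) : coords 𝕜 E x x a = a := by
  rw [coords_eq_tangentCoordChange (mem_chart_source E x)]
  have h : ∀ v : E, tangentCoordChange 𝓘(𝕜, E) x x x v = v :=
    fun v => tangentCoordChange_self (mem_extChartAt_source x)
  exact h a

theorem ofCoords_self (x : M) (a : E) : ofCoords 𝕜 E x x a = a := by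
  rw [ofCoords_eq_tangentCoordChange (mem_chart_source E x)]
  have h : ∀ v : E, tangentCoordChange 𝓘(𝕜, E) x x x v = v :=
    fun v => tangentCoordChange_self (mem_extChartAt_source x)
  exact h a

theorem coordField_self {x : M} (a : TangentSpace 𝓘(𝕜, E) x) : coordField a x = a :=
  ofCoords_coords (mem_chart_source E x) a

/-- The coordinates at `y` with respect to the preferred chart at `x` are given by the derivative
of that chart, not only at the base point. -/
theorem coords_eq_mfderiv {x y : M} (hy : y ∈ (chartAt E x).source) :
    coords 𝕜 E x y = mfderiv 𝓘(𝕜, E) 𝓘(𝕜, E) (extChartAt 𝓘(𝕜, E) x) y :=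
  TangentBundle.continuousLinearMapAt_trivializationAt hy

theorem smoothFieldAt_iff_of_mem {X : Π x : M, TangentSpace 𝓘(𝕜, E) x} {x y : M}
    (hy : y ∈ (chartAt E x).source) :
    SmoothFieldAt X y ↔ ContMDiffAt 𝓘(𝕜, E) 𝓘(𝕜, E) ∞ (fun z => coords 𝕜 E x z (X z)) y := by
  unfold SmoothFieldAt
  rw [(trivializationAt E (TangentSpace 𝓘(𝕜, E) : M → Type _) x).contMDiffAt_section_iff
    (by simpa using hy)]
  refine Filter.EventuallyEq.contMDiffAt_iff ?_
  filter_upwards [(chartAt E x).open_source.mem_nhds hy] with z hz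
  rw [coords, Bundle.Trivialization.continuousLinearMapAt_apply,
    Bundle.Trivialization.coe_linearMapAt_of_mem _ (by simpa using hz)]

theorem smoothFieldAt_ofCoords {x y : M} (hy : y ∈ (chartAt E x).source) {X : M → E}
    (hX : ContMDiffAt 𝓘(𝕜, E) 𝓘(𝕜, E) ∞ X y) :
    SmoothFieldAt (fun z => ofCoords 𝕜 E x z (X z)) y := by
  rw [smoothFieldAt_iff_of_mem hy]
  refine hX.congr_of_eventuallyEq ?_
  filter_upwards [(chartAt E x).open_source.mem_nhds hy] with z hz
  exact coords_ofCoords hz _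

theorem smoothFieldAt_coordField {x : M} (a : TangentSpace 𝓘(𝕜, E) x) :
    SmoothFieldAt (coordField a) x :=
  smoothFieldAt_ofCoords (mem_chart_source E x) contMDiffAt_const

/-- The expression, in the preferred chart at `x`, of a function with values in a vector space. -/
def inChart (𝕜 : Type*) [RCLike 𝕜] {E : Type*} [NormedAddCommGroup E] [NormedSpace 𝕜 E]
    {M : Type*} [TopologicalSpace M] [ChartedSpace E M] {W : Type*} (x : M) (h : M → W) (p : E) :
    W :=
  h ((extChartAt 𝓘(𝕜, E) x).symm p)

section InChart

variable {W : Type*} [NormedAddCommGroup W] [NormedSpace 𝕜 W]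

theorem mem_extChartAt_target_of_mem {x y : M} (hy : y ∈ (chartAt E x).source) :
    (extChartAt 𝓘(𝕜, E) x y) ∈ (extChartAt 𝓘(𝕜, E) x).target :=
  (extChartAt 𝓘(𝕜, E) x).map_source (by rwa [extChartAt_source])

theorem extChartAt_symm_apply {x y : M} (hy : y ∈ (chartAt E x).source) :
    (extChartAt 𝓘(𝕜, E) x).symm (extChartAt 𝓘(𝕜, E) x y) = y :=
  (extChartAt 𝓘(𝕜, E) x).left_inv (by rwa [extChartAt_source])

theorem inChart_extChartAt {x y : M} (hy : y ∈ (chartAt E x).source) (h : M → W) :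
    inChart 𝕜 x h (extChartAt 𝓘(𝕜, E) x y) = h y := by
  rw [inChart, extChartAt_symm_apply hy]

theorem tendsto_extChartAt_symm {x y : M} (hy : y ∈ (chartAt E x).source) :
    Filter.Tendsto (extChartAt 𝓘(𝕜, E) x).symm (𝓝 (extChartAt 𝓘(𝕜, E) x y)) (𝓝 y) := by
  have h := continuousAt_extChartAt_symm' (I := 𝓘(𝕜, E)) (x := x) (x' := y)
    (by rwa [extChartAt_source])
  rwa [ContinuousAt, extChartAt_symm_apply hy] at h

theorem contDiffAt_inChart {x y : M} (hy : y ∈ (chartAt E x).source) {h : M → W}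
    (hh : ContMDiffAt 𝓘(𝕜, E) 𝓘(𝕜, W) ∞ h y) :
    ContDiffAt 𝕜 ∞ (inChart 𝕜 x h) (extChartAt 𝓘(𝕜, E) x y) := by
  rw [← contMDiffAt_iff_contDiffAt]
  have h1 : ContMDiffAt 𝓘(𝕜, E) 𝓘(𝕜, E) ∞ (extChartAt 𝓘(𝕜, E) x).symm
      (extChartAt 𝓘(𝕜, E) x y) :=
    (contMDiffOn_extChartAt_symm x).contMDiffAt
      ((isOpen_extChartAt_target x).mem_nhds (mem_extChartAt_target_of_mem hy))
  exact ContMDiffAt.comp_of_eq hh h1 (extChartAt_symm_apply hy)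

theorem mvfderiv_eq_fderiv_inChart {x y : M} (hy : y ∈ (chartAt E x).source) {h : M → W}
    (hh : ContMDiffAt 𝓘(𝕜, E) 𝓘(𝕜, W) ∞ h y) (a : TangentSpace 𝓘(𝕜, E) y) :
    mvfderiv 𝓘(𝕜, E) h y a
      = fderiv 𝕜 (inChart 𝕜 x h) (extChartAt 𝓘(𝕜, E) x y) (coords 𝕜 E x y a) := by
  have h1 : h =ᶠ[𝓝 y] inChart 𝕜 x h ∘ extChartAt 𝓘(𝕜, E) x := by
    filter_upwards [(chartAt E x).open_source.mem_nhds hy] with z hz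
    exact (inChart_extChartAt hz h).symm
  have h2 : MDifferentiableAt 𝓘(𝕜, E) 𝓘(𝕜, W) (inChart 𝕜 x h) (extChartAt 𝓘(𝕜, E) x y) :=
    ((contDiffAt_inChart hy hh).differentiableAt (by simp)).mdifferentiableAt
  have h3 : MDifferentiableAt 𝓘(𝕜, E) 𝓘(𝕜, E) (extChartAt 𝓘(𝕜, E) x) y :=
    mdifferentiableAt_extChartAt hy
  have h4 := mfderiv_comp y h2 h3
  have h5 : mfderiv 𝓘(𝕜, E) 𝓘(𝕜, W) h y
      = mfderiv 𝓘(𝕜, E) 𝓘(𝕜, W) (inChart 𝕜 x h ∘ extChartAt 𝓘(𝕜, E) x) y := h1.mfderiv_eq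
  rw [coords_eq_mfderiv hy]
  change mfderiv 𝓘(𝕜, E) 𝓘(𝕜, W) h y a = _
  rw [h5, h4, mfderiv_eq_fderiv]
  rfl

theorem mvfderiv_eq_fderiv_inChart_self {x : M} {h : M → W}
    (hh : ContMDiffAt 𝓘(𝕜, E) 𝓘(𝕜, W) ∞ h x) (a : TangentSpace 𝓘(𝕜, E) x) :
    mvfderiv 𝓘(𝕜, E) h x a = fderiv 𝕜 (inChart 𝕜 x h) (extChartAt 𝓘(𝕜, E) x x) a := by
  rw [mvfderiv_eq_fderiv_inChart (mem_chart_source E x) hh, coords_self]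

theorem mvfderiv_congr {h h' : M → W} {x : M} (hh : h =ᶠ[𝓝 x] h') :
    (mvfderiv 𝓘(𝕜, E) h x : E →L[𝕜] W) = mvfderiv 𝓘(𝕜, E) h' x := by
  have := hh.mfderiv_eq (I := 𝓘(𝕜, E)) (I' := 𝓘(𝕜, W))
  ext a
  exact DFunLike.congr_fun this a

end InChart

/-- The Lie bracket at `x` has the usual coordinate expression `DY(X) - DX(Y)` in the preferred
chart at `x`. No smoothness is needed, because both sides are built from the same derivatives. -/
theorem coords_mlieBracket {X Y : Π x : M, TangentSpace 𝓘(𝕜, E) x} (x : M) :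
    coords 𝕜 E x x (VectorField.mlieBracket 𝓘(𝕜, E) X Y x)
      = fderiv 𝕜 (inChart 𝕜 x fun y => coords 𝕜 E x y (Y y)) (extChartAt 𝓘(𝕜, E) x x)
          (coords 𝕜 E x x (X x))
        - fderiv 𝕜 (inChart 𝕜 x fun y => coords 𝕜 E x y (X y)) (extChartAt 𝓘(𝕜, E) x x)
          (coords 𝕜 E x x (Y x)) := by
  have key : ∀ Z : Π x : M, TangentSpace 𝓘(𝕜, E) x,
      VectorField.mpullbackWithin 𝓘(𝕜, E) 𝓘(𝕜, E) (extChartAt 𝓘(𝕜, E) x).symm Z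
        (Set.range 𝓘(𝕜, E)) =ᶠ[𝓝 (extChartAt 𝓘(𝕜, E) x x)]
      inChart 𝕜 x fun y => coords 𝕜 E x y (Z y) := by
    intro Z
    filter_upwards [(isOpen_extChartAt_target x).mem_nhds (mem_extChartAt_target x)] with p hp
    have hs : (extChartAt 𝓘(𝕜, E) x).symm p ∈ (chartAt E x).source := by
      rw [← extChartAt_source 𝓘(𝕜, E)]; exact (extChartAt 𝓘(𝕜, E) x).map_target hp
    have h1 := TangentBundle.symmL_trivializationAt (I := 𝓘(𝕜, E)) hs
    rw [(extChartAt 𝓘(𝕜, E) x).right_inv hp] at h1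
    have h2 : (ofCoords 𝕜 E x ((extChartAt 𝓘(𝕜, E) x).symm p)).inverse
      = coords 𝕜 E x ((extChartAt 𝓘(𝕜, E) x).symm p) := by
      apply ContinuousLinearMap.inverse_eq
      · ext a; exact ofCoords_coords hs a
      · ext a; exact coords_ofCoords hs a
    have h3 := (congrArg (fun L => ContinuousLinearMap.inverse L) h1).symm.trans h2
    exact DFunLike.congr_fun h3 (Z ((extChartAt 𝓘(𝕜, E) x).symm p))
  have hid : ∀ a : E, (mfderiv 𝓘(𝕜, E) 𝓘(𝕜, E) (extChartAt 𝓘(𝕜, E) x) x).inverse a = a := by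
    intro a
    rw [mfderiv_extChartAt_self]
    exact DFunLike.congr_fun (ContinuousLinearMap.inverse_id (R := 𝕜) (M := E)) a
  have hself : ∀ Z : Π x : M, TangentSpace 𝓘(𝕜, E) x,
      inChart 𝕜 x (fun y => coords 𝕜 E x y (Z y)) (extChartAt 𝓘(𝕜, E) x x)
        = coords 𝕜 E x x (Z x) :=
    fun Z => inChart_extChartAt (mem_chart_source E x) _
  rw [coords_self, ← VectorField.mlieBracketWithin_univ, VectorField.mlieBracketWithin_apply]
  refine (hid _).trans ?_
  rw [← hself X, ← hself Y, ← (key X).fderiv_eq, ← (key Y).fderiv_eq, ← (key X).self_of_nhds,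
    ← (key Y).self_of_nhds]
  simp only [modelWithCornersSelf_coe, Set.range_id, Set.preimage_univ, Set.inter_univ]
  exact congrFun (VectorField.lieBracketWithin_univ (𝕜 := 𝕜) (E := E)) _

end Coordinates

/-! ### Components of tensors and the exterior derivative -/

section Components

variable {𝕜 : Type*} [RCLike 𝕜] {E : Type*} [NormedAddCommGroup E] [NormedSpace 𝕜 E]
  {M : Type*} [TopologicalSpace M] [ChartedSpace E M] [IsManifold 𝓘(𝕜, E) ∞ M]

/-- The components of a vector field in the preferred chart at `x`. -/
def vecComp (x : M) (X : Π x : M, TangentSpace 𝓘(𝕜, E) x) (y : M) : E :=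
  coords 𝕜 E x y (X y)

/-- The components of a `1`-form in the preferred chart at `x`. -/
def covComp (x : M) (α : Π x : M, TangentSpace 𝓘(𝕜, E) x →L[𝕜] 𝕜) (y : M) : E →L[𝕜] 𝕜 :=
  (α y).comp (ofCoords 𝕜 E x y)

/-- The components of a `(1, 1)`-tensor in the preferred chart at `x`. -/
def endComp (x : M) (G : Π x : M, TangentSpace 𝓘(𝕜, E) x →L[𝕜] TangentSpace 𝓘(𝕜, E) x) (y : M) :
    E →L[𝕜] E :=
  (coords 𝕜 E x y).comp ((G y).comp (ofCoords 𝕜 E x y))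

/-- The components of a field of bilinear forms in the preferred chart at `x`. -/
def bilinComp (x : M)
    (g : Π x : M, TangentSpace 𝓘(𝕜, E) x →L[𝕜] TangentSpace 𝓘(𝕜, E) x →L[𝕜] 𝕜) (y : M) :
    E →L[𝕜] E →L[𝕜] 𝕜 :=
  ((ofCoords 𝕜 E x y).precomp 𝕜).comp ((g y).comp (ofCoords 𝕜 E x y))

theorem covComp_apply (x : M) (α : Π x : M, TangentSpace 𝓘(𝕜, E) x →L[𝕜] 𝕜) (y : M) (a : E) :
    covComp x α y a = α y (ofCoords 𝕜 E x y a) := rfl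

theorem endComp_apply (x : M)
    (G : Π x : M, TangentSpace 𝓘(𝕜, E) x →L[𝕜] TangentSpace 𝓘(𝕜, E) x) (y : M) (a : E) :
    endComp x G y a = coords 𝕜 E x y (G y (ofCoords 𝕜 E x y a)) := rfl

theorem bilinComp_apply (x : M)
    (g : Π x : M, TangentSpace 𝓘(𝕜, E) x →L[𝕜] TangentSpace 𝓘(𝕜, E) x →L[𝕜] 𝕜) (y : M) (a b : E) :
    bilinComp x g y a b = g y (ofCoords 𝕜 E x y a) (ofCoords 𝕜 E x y b) := rfl

theorem contMDiffAt_vecComp {x y : M} (hy : y ∈ (chartAt E x).source)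
    {X : Π x : M, TangentSpace 𝓘(𝕜, E) x} (hX : SmoothFieldAt X y) :
    ContMDiffAt 𝓘(𝕜, E) 𝓘(𝕜, E) ∞ (vecComp x X) y :=
  (smoothFieldAt_iff_of_mem hy).1 hX

theorem contMDiffAt_covComp {x y : M} (hy : y ∈ (chartAt E x).source)
    {α : Π x : M, TangentSpace 𝓘(𝕜, E) x →L[𝕜] 𝕜}
    (hα : ContMDiffAt 𝓘(𝕜, E) (𝓘(𝕜, E).prod 𝓘(𝕜, E →L[𝕜] 𝕜)) ∞
      (fun x => Bundle.TotalSpace.mk' (E →L[𝕜] 𝕜)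
        (E := fun x : M => TangentSpace 𝓘(𝕜, E) x →L[𝕜] 𝕜) x (α x)) y) :
    ContMDiffAt 𝓘(𝕜, E) 𝓘(𝕜, E →L[𝕜] 𝕜) ∞ (covComp x α) y := by
  have h := ((trivializationAt (E →L[𝕜] 𝕜)
    (fun x : M => TangentSpace 𝓘(𝕜, E) x →L[𝕜] 𝕜) x).contMDiffAt_section_iff
      (by simpa [hom_trivializationAt_baseSet] using hy)).1 hα
  refine h.congr_of_eventuallyEq (Filter.Eventually.of_forall fun z => ?_)
  dsimp only
  rw [hom_trivializationAt_apply]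
  ext a
  simp [ContinuousLinearMap.inCoordinates, covComp, ofCoords]

theorem contMDiffAt_endComp {x y : M} (hy : y ∈ (chartAt E x).source)
    {G : Π x : M, TangentSpace 𝓘(𝕜, E) x →L[𝕜] TangentSpace 𝓘(𝕜, E) x}
    (hG : ContMDiffAt 𝓘(𝕜, E) (𝓘(𝕜, E).prod 𝓘(𝕜, E →L[𝕜] E)) ∞
      (fun x => Bundle.TotalSpace.mk' (E →L[𝕜] E)
        (E := fun x : M => TangentSpace 𝓘(𝕜, E) x →L[𝕜] TangentSpace 𝓘(𝕜, E) x) x (G x)) y) :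
    ContMDiffAt 𝓘(𝕜, E) 𝓘(𝕜, E →L[𝕜] E) ∞ (endComp x G) y := by
  have h := ((trivializationAt (E →L[𝕜] E)
    (fun x : M => TangentSpace 𝓘(𝕜, E) x →L[𝕜] TangentSpace 𝓘(𝕜, E) x) x).contMDiffAt_section_iff
      (by simpa [hom_trivializationAt_baseSet] using hy)).1 hG
  refine h.congr_of_eventuallyEq (Filter.Eventually.of_forall fun z => ?_)
  dsimp only
  rw [hom_trivializationAt_apply]
  rfl

theorem contMDiffAt_bilinComp {x y : M} (hy : y ∈ (chartAt E x).source)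
    {g : Π x : M, TangentSpace 𝓘(𝕜, E) x →L[𝕜] TangentSpace 𝓘(𝕜, E) x →L[𝕜] 𝕜}
    (hg : ContMDiffAt 𝓘(𝕜, E) (𝓘(𝕜, E).prod 𝓘(𝕜, E →L[𝕜] E →L[𝕜] 𝕜)) ∞
      (fun x => Bundle.TotalSpace.mk' (E →L[𝕜] E →L[𝕜] 𝕜)
        (E := fun x : M => TangentSpace 𝓘(𝕜, E) x →L[𝕜] TangentSpace 𝓘(𝕜, E) x →L[𝕜] 𝕜)
        x (g x)) y) :
    ContMDiffAt 𝓘(𝕜, E) 𝓘(𝕜, E →L[𝕜] E →L[𝕜] 𝕜) ∞ (bilinComp x g) y := by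
  have h := ((trivializationAt (E →L[𝕜] E →L[𝕜] 𝕜)
    (fun x : M => TangentSpace 𝓘(𝕜, E) x →L[𝕜] TangentSpace 𝓘(𝕜, E) x →L[𝕜] 𝕜)
      x).contMDiffAt_section_iff
      (by simpa [hom_trivializationAt_baseSet] using hy)).1 hg
  refine h.congr_of_eventuallyEq ?_
  filter_upwards [(chartAt E x).open_source.mem_nhds hy] with z hz
  rw [hom_trivializationAt_apply]
  ext a b
  rw [bilinComp_apply]
  simp only [ContinuousLinearMap.inCoordinates, ContinuousLinearMap.comp_apply,
    Bundle.Trivialization.continuousLinearMapAt_apply]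
  rw [Bundle.Trivialization.coe_linearMapAt_of_mem _
    (by simpa [hom_trivializationAt_baseSet] using hz)]
  simp [hom_trivializationAt_apply, ContinuousLinearMap.inCoordinates, ofCoords]

/-- The exterior derivative at `y`, defined with the chart at `y`, has the same expression in the
chart at any nearby `x`: the second derivatives of the transition map are symmetric, so they
cancel. This makes the formula for `du` available at all points of one chart, where it can be
differentiated again. -/
theorem extDeriv_eq_fderiv_inChart {x y : M} (hy : y ∈ (chartAt E x).source)
    {α : Π x : M, TangentSpace 𝓘(𝕜, E) x →L[𝕜] 𝕜}
    (hα : ContMDiffAt 𝓘(𝕜, E) 𝓘(𝕜, E →L[𝕜] 𝕜) ∞ (covComp x α) y)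
    (a b : TangentSpace 𝓘(𝕜, E) y) :
    extDeriv α y a b = (1 / 2) *
      (fderiv 𝕜 (inChart 𝕜 x (covComp x α)) (extChartAt 𝓘(𝕜, E) x y)
          (coords 𝕜 E x y a) (coords 𝕜 E x y b)
        - fderiv 𝕜 (inChart 𝕜 x (covComp x α)) (extChartAt 𝓘(𝕜, E) x y)
          (coords 𝕜 E x y b) (coords 𝕜 E x y a)) := by
  -- the transition map from the chart at `y` to the chart at `x`
  set ψ : E → E := extChartAt 𝓘(𝕜, E) x ∘ (extChartAt 𝓘(𝕜, E) y).symm with hψ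
  set o : E := extChartAt 𝓘(𝕜, E) y y with ho
  have hyy := mem_chart_source E y
  have hext : ContMDiffAt 𝓘(𝕜, E) 𝓘(𝕜, E) ∞ (extChartAt 𝓘(𝕜, E) x) y :=
    contMDiffAt_extChartAt' hy
  have hψs : ContDiffAt 𝕜 ∞ ψ o := contDiffAt_inChart hyy hext
  have hψo : ψ o = extChartAt 𝓘(𝕜, E) x y := inChart_extChartAt hyy _
  have hsymm : IsSymmSndFDerivAt 𝕜 ψ o := hψs.isSymmSndFDerivAt
    (by rw [minSmoothness_of_isRCLikeNormedField]; exact WithTop.coe_le_coe.2 le_top)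
  have hψ1 : ∀ᶠ p in 𝓝 o, ∀ b : E, coords 𝕜 E x ((extChartAt 𝓘(𝕜, E) y).symm p)
      (ofCoords 𝕜 E y ((extChartAt 𝓘(𝕜, E) y).symm p) b) = fderiv 𝕜 ψ p b := by
    have h1 := (tendsto_extChartAt_symm (𝕜 := 𝕜) hyy).eventually
      ((chartAt E x).open_source.mem_nhds hy)
    filter_upwards [h1, (isOpen_extChartAt_target y).mem_nhds (mem_extChartAt_target y)]
      with p hp1 hp2 b
    have hp3 : (extChartAt 𝓘(𝕜, E) y).symm p ∈ (chartAt E y).source := by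
      rw [← extChartAt_source 𝓘(𝕜, E)]; exact (extChartAt 𝓘(𝕜, E) y).map_target hp2
    set z := (extChartAt 𝓘(𝕜, E) y).symm p with hz
    have h2 := tangentCoordChange_comp (I := 𝓘(𝕜, E)) (w := y) (x := z) (y := x) (z := z) (v := b)
      (by simp only [extChartAt_source]; exact ⟨⟨hp3, mem_chart_source E z⟩, hp1⟩)
    rw [coords_eq_tangentCoordChange hp1, ofCoords_eq_tangentCoordChange hp3]
    refine h2.trans ?_
    rw [tangentCoordChange_def, hz, (extChartAt 𝓘(𝕜, E) y).right_inv hp2]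
    simp [hψ]
  have hψ' : HasFDerivAt (fderiv 𝕜 ψ) (fderiv 𝕜 (fderiv 𝕜 ψ) o) o :=
    ((hψs.fderiv_right (m := ∞) (by simp)).differentiableAt (by simp)).hasFDerivAt
  have hα' := contDiffAt_inChart hy hα
  -- the derivative of the components of the form in the chart at `y`, with the correction by the
  -- second derivative of the transition map
  have key : ∀ a b : TangentSpace 𝓘(𝕜, E) y,
      mvfderiv 𝓘(𝕜, E) (fun z => α z (coordField b z)) y a
        = fderiv 𝕜 (inChart 𝕜 x (covComp x α)) (extChartAt 𝓘(𝕜, E) x y)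
            (coords 𝕜 E x y a) (coords 𝕜 E x y b)
          + covComp x α y (fderiv 𝕜 (fderiv 𝕜 ψ) o a b) := by
    intro a b
    have h1 : ContMDiffAt 𝓘(𝕜, E) 𝓘(𝕜, 𝕜) ∞ (fun z => α z (coordField b z)) y := by
      have h2 := hα.clm_apply (contMDiffAt_vecComp hy (smoothFieldAt_coordField b))
      refine h2.congr_of_eventuallyEq ?_
      filter_upwards [(chartAt E x).open_source.mem_nhds hy] with z hz
      rw [covComp_apply, vecComp, ofCoords_coords hz]
    have h2 : inChart 𝕜 y (fun z => α z (coordField b z)) =ᶠ[𝓝 o]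
        fun p => inChart 𝕜 x (covComp x α) (ψ p) (fderiv 𝕜 ψ p b) := by
      filter_upwards [hψ1, (tendsto_extChartAt_symm (𝕜 := 𝕜) hyy).eventually
        ((chartAt E x).open_source.mem_nhds hy)] with p hp hp'
      rw [← hp b]
      have h3 : ψ p = extChartAt 𝓘(𝕜, E) x ((extChartAt 𝓘(𝕜, E) y).symm p) := rfl
      rw [h3, inChart_extChartAt hp', covComp_apply, ofCoords_coords hp', inChart, coordField,
        coords_self]
    have h3 : ∀ a b : E, fderiv 𝕜 (fun p => inChart 𝕜 x (covComp x α) (ψ p) (fderiv 𝕜 ψ p b)) o a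
        = fderiv 𝕜 (inChart 𝕜 x (covComp x α)) (ψ o) (fderiv 𝕜 ψ o a) (fderiv 𝕜 ψ o b)
          + inChart 𝕜 x (covComp x α) (ψ o) (fderiv 𝕜 (fderiv 𝕜 ψ) o a b) := by
      intro a b
      rw [← hψo] at hα'
      have h := ((hα'.differentiableAt (by simp)).hasFDerivAt.comp o
        (hψs.differentiableAt (by simp)).hasFDerivAt).clm_apply
        (hψ'.clm_apply (hasFDerivAt_const b o))
      refine (DFunLike.congr_fun h.fderiv a).trans ?_
      simp [add_comm]
    have h5 : ∀ c : E, fderiv 𝕜 ψ o c = coords 𝕜 E x y c := by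
      intro c
      have := hψ1.self_of_nhds c
      rw [ho, extChartAt_symm_apply hyy, ofCoords_self] at this
      exact this.symm
    simp only [h5, hψo, inChart_extChartAt hy] at h3
    rw [mvfderiv_eq_fderiv_inChart_self h1]
    exact (DFunLike.congr_fun h2.fderiv_eq (a : E)).trans (h3 a b)
  have h : covComp x α y (fderiv 𝕜 (fderiv 𝕜 ψ) o a b)
      = covComp x α y (fderiv 𝕜 (fderiv 𝕜 ψ) o b a) := congrArg _ (hsymm.eq (a : E) (b : E))
  rw [extDeriv, key, key, h]
  ring

end Components

/-! ### The complex structure in real charts -/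

section RealComplex

variable {E : Type*} [NormedAddCommGroup E] [NormedSpace ℂ E]
  {M : Type*} [TopologicalSpace M] [ChartedSpace E M] [IsManifold 𝓘(ℂ, E) ∞ M]

/-- In every preferred chart, and not only in the one that defines `J` at the given point, `J` is
multiplication by `i`: the transition maps are holomorphic. -/
theorem coords_J {x y : M} (hy : y ∈ (chartAt E x).source) (a : TangentSpace 𝓘(ℝ, E) y) :
    coords ℝ E x y (J y a) = Complex.I • coords ℝ E x y a := by
  have hJ : J y a = (Complex.I • (id a : E) : E) := by
    change ofCoords ℝ E y y (Complex.I • coords ℝ E y y a) = _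
    rw [ofCoords_self, coords_self]
    rfl
  have hd : DifferentiableAt ℂ (extChartAt 𝓘(ℂ, E) x ∘ (extChartAt 𝓘(ℂ, E) y).symm)
      (extChartAt 𝓘(ℂ, E) y y) :=
    (contDiffAt_inChart (mem_chart_source E y) (contMDiffAt_extChartAt' hy)).differentiableAt
      (by simp)
  have h : ∀ v : E, tangentCoordChange 𝓘(ℝ, E) y x y v
      = fderiv ℂ (extChartAt 𝓘(ℂ, E) x ∘ (extChartAt 𝓘(ℂ, E) y).symm)
        (extChartAt 𝓘(ℂ, E) y y) v := by
    intro v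
    rw [tangentCoordChange_def]
    have h1 := DFunLike.congr_fun (hd.fderiv_restrictScalars ℝ) v
    simpa using h1
  have h2 : ∀ v : E, tangentCoordChange 𝓘(ℝ, E) y x y (Complex.I • v)
      = Complex.I • tangentCoordChange 𝓘(ℝ, E) y x y v := by
    intro v
    rw [h, h, map_smul]
  rw [coords_eq_tangentCoordChange hy, hJ]
  exact h2 a

end RealComplex

/-! ### Christoffel symbols -/

section Christoffel

variable {E : Type*} [NormedAddCommGroup E] [NormedSpace ℝ E]
  {M : Type*} [TopologicalSpace M] [ChartedSpace E M] [IsManifold 𝓘(ℝ, E) ∞ M]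

namespace SemiRiemannianMetric

variable (g : SemiRiemannianMetric E M)

/-- The metric in the preferred chart at `x`. -/
def inChart (x : M) : E → E →L[ℝ] E →L[ℝ] ℝ :=
  ComplexContact.inChart ℝ x (bilinComp x g.inner)

theorem contMDiffAt_bilinComp {x y : M} (hy : y ∈ (chartAt E x).source) :
    ContMDiffAt 𝓘(ℝ, E) 𝓘(ℝ, E →L[ℝ] E →L[ℝ] ℝ) ∞ (bilinComp x g.inner) y :=
  ComplexContact.contMDiffAt_bilinComp hy (g.smooth y)

theorem differentiableAt_inChart (x : M) :
    DifferentiableAt ℝ (g.inChart x) (extChartAt 𝓘(ℝ, E) x x) :=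
  (contDiffAt_inChart (mem_chart_source E x)
    (g.contMDiffAt_bilinComp (mem_chart_source E x))).differentiableAt (by simp)

theorem inChart_coords (x : M) (a b : TangentSpace 𝓘(ℝ, E) x) :
    g.inChart x (extChartAt 𝓘(ℝ, E) x x) (coords ℝ E x x a) (coords ℝ E x x b) = g.inner x a b := by
  have hx := mem_chart_source E x
  rw [inChart, inChart_extChartAt hx, bilinComp_apply, ofCoords_coords hx, ofCoords_coords hx]

/-- The Koszul form in terms of the derivative of the metric in the preferred chart. -/
theorem koszul_apply (x : M) (a b c : TangentSpace 𝓘(ℝ, E) x) :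
    g.koszul x a b c
      = fderiv ℝ (g.inChart x) (extChartAt 𝓘(ℝ, E) x x) (coords ℝ E x x a) (coords ℝ E x x b)
          (coords ℝ E x x c)
        + fderiv ℝ (g.inChart x) (extChartAt 𝓘(ℝ, E) x x) (coords ℝ E x x b) (coords ℝ E x x a)
          (coords ℝ E x x c)
        - fderiv ℝ (g.inChart x) (extChartAt 𝓘(ℝ, E) x x) (coords ℝ E x x c) (coords ℝ E x x a)
          (coords ℝ E x x b) := by
  have hx := mem_chart_source E x
  have hs := g.contMDiffAt_bilinComp hx
  have hd := (g.differentiableAt_inChart x).hasFDerivAt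
  have h2 : ∀ (a b : TangentSpace 𝓘(ℝ, E) x) (c : E), mvfderiv 𝓘(ℝ, E) (g.lowered b) x a c
      = fderiv ℝ (g.inChart x) (extChartAt 𝓘(ℝ, E) x x) (coords ℝ E x x a) (coords ℝ E x x b)
        c := by
    intro a b c
    have h1 : g.lowered b = fun y => bilinComp x g.inner y (coords ℝ E x x b) := rfl
    rw [h1, mvfderiv_eq_fderiv_inChart hx (hs.clm_apply contMDiffAt_const)]
    have h3 := (hd.clm_apply (hasFDerivAt_const (coords ℝ E x x b) _)).fderiv
    have h4 := DFunLike.congr_fun (DFunLike.congr_fun h3 (coords ℝ E x x a)) c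
    refine h4.trans ?_
    simp
  have h3 : mvfderiv 𝓘(ℝ, E) (fun y => g.inner y (coordField a y) (coordField b y)) x c
      = fderiv ℝ (g.inChart x) (extChartAt 𝓘(ℝ, E) x x) (coords ℝ E x x c) (coords ℝ E x x a)
          (coords ℝ E x x b) := by
    have h4 : (fun y => g.inner y (coordField a y) (coordField b y))
        = fun y => bilinComp x g.inner y (coords ℝ E x x a) (coords ℝ E x x b) := rfl
    rw [h4, mvfderiv_eq_fderiv_inChart hx
      ((hs.clm_apply contMDiffAt_const).clm_apply contMDiffAt_const)]
    have h3 := ((hd.clm_apply (hasFDerivAt_const (coords ℝ E x x a) _)).clm_apply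
      (hasFDerivAt_const (coords ℝ E x x b) _)).fderiv
    refine (DFunLike.congr_fun h3 (coords ℝ E x x c)).trans ?_
    simp
  rw [← h2, ← h2, ← h3]
  rfl

theorem inner_christoffel [FiniteDimensional ℝ E] (x : M) (a b c : TangentSpace 𝓘(ℝ, E) x) :
    g.inner x (g.christoffel x a b) c = (1 / 2) * g.koszul x a b c := by
  have h := LinearMap.congr_fun
    ((g.flat x).apply_symm_apply (g.koszul x a b).toLinearMap) c
  have h' : g.inner x ((g.flat x).symm (g.koszul x a b).toLinearMap) c = g.koszul x a b c := h
  rw [christoffel, map_smul, smul_apply, h', smul_eq_mul]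

end SemiRiemannianMetric

end Christoffel

/-! ### The Levi-Civita derivative of the characteristic field -/

section Killing

variable {E : Type*} [NormedAddCommGroup E] [NormedSpace ℂ E]
  {M : Type*} [TopologicalSpace M] [ChartedSpace E M] [IsManifold 𝓘(ℂ, E) ∞ M]

theorem J_J (x : M) (a : TangentSpace 𝓘(ℝ, E) x) : J x (J x a) = -a := by
  have h : ∀ a : TangentSpace 𝓘(ℝ, E) x, coords ℝ E x x (J x (J x a)) = -coords ℝ E x x a := by
    intro a
    rw [coords_J (mem_chart_source E x), coords_J (mem_chart_source E x), smul_smul,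
      Complex.I_mul_I, neg_one_smul]
  have := h a
  rwa [coords_self, coords_self] at this

theorem ofCoords_I_smul {x y : M} (hy : y ∈ (chartAt E x).source) (a : E) :
    ofCoords ℝ E x y (Complex.I • a) = J y (ofCoords ℝ E x y a) := by
  have h := coords_J hy (ofCoords ℝ E x y a)
  rw [coords_ofCoords hy] at h
  rw [← h, ofCoords_coords hy]

namespace LocalTensors

variable {t : LocalTensors E M} {g : SemiRiemannianMetric E M} {x : M}

theorem Laws.v_U (h : t.Laws g x)
    (herm : ∀ a b, g.inner x (J x a) (J x b) = g.inner x a b) : t.v x (t.U x) = 0 := by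
  have h1 : t.v x (t.U x) = g.inner x (t.U x) (J x (t.U x)) := (h.dual _).symm
  have h2 := herm (t.U x) (J x (t.U x))
  rw [J_J, map_neg, g.symm] at h2
  rw [h1]
  linarith

theorem Laws.u_G (h : t.Laws g x) (a : TangentSpace 𝓘(ℝ, E) x) : t.u x (t.G x a) = 0 := by
  rw [← h.dual, ← neg_eq_zero, ← h.G_skew, h.G_U]; simp

theorem Laws.H_U (h : t.Laws g x) : t.H x (t.U x) = 0 := by
  have : t.H x (t.U x) = t.G x (J x (t.U x)) := rfl
  rw [this, h.G_J, h.G_U]; simp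

theorem Laws.G_V (h : t.Laws g x) : t.G x (t.V x) = 0 := by
  have : t.V x = - J x (t.U x) := rfl
  rw [this, map_neg, h.G_J, h.G_U]; simp

theorem Laws.inner_V (h : t.Laws g x)
    (herm : ∀ a b, g.inner x (J x a) (J x b) = g.inner x a b) (a : TangentSpace 𝓘(ℝ, E) x) :
    g.inner x (t.V x) a = t.v x a := by
  have h1 := herm (J x (t.U x)) a
  have h2 : t.v x a = t.u x (J x a) := rfl
  have h3 : t.V x = - J x (t.U x) := rfl
  rw [J_J, map_neg, neg_apply] at h1
  rw [h2, h3, ← h.dual, map_neg, neg_apply, ← h1, neg_neg]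

theorem coords_G (x : M) (a : TangentSpace 𝓘(ℝ, E) x) :
    coords ℝ E x x (t.G x a)
      = inChart ℝ x (endComp x t.G) (extChartAt 𝓘(ℝ, E) x x) (coords ℝ E x x a) := by
  have hx := mem_chart_source E x
  rw [inChart_extChartAt hx, endComp_apply, ofCoords_coords hx]

/-- The equation `S(U, c) = 0`, for a coordinate field `c`, in the preferred chart at `x`. Since
`G U = H U = 0` and `u ∘ G = 0`, only the bracket terms and one term with `σ(U)` remain. -/
theorem S_U_in_chart {O : Set M} (hO : IsOpen O) (hx : x ∈ O) (hs : t.SmoothOn O)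
    (hl : ∀ y ∈ O, t.Laws g y)
    (herm : ∀ x a b, g.inner x (J x a) (J x b) = g.inner x a b)
    (hn : ∀ X : Π x : M, TangentSpace 𝓘(ℝ, E) x, SmoothFieldAt X x → t.S g t.U X x = 0)
    {o : E} (ho : o = extChartAt 𝓘(ℝ, E) x x) (c : E) :
    -inChart ℝ x (endComp x t.G) o (inChart ℝ x (endComp x t.G) o
        (fderiv ℝ (inChart ℝ x (vecComp x t.U)) o c))
      - inChart ℝ x (endComp x t.G) o
        (fderiv ℝ (inChart ℝ x (endComp x t.G)) o (inChart ℝ x (vecComp x t.U) o) c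
          - fderiv ℝ (inChart ℝ x (vecComp x t.U)) o (inChart ℝ x (endComp x t.G) o c))
      + inChart ℝ x (covComp x t.σ) o (inChart ℝ x (vecComp x t.U) o) •
        inChart ℝ x (endComp x t.G) o (inChart ℝ x (endComp x t.G) o (Complex.I • c)) = 0 := by
  subst ho
  have hxs := mem_chart_source E x
  have hnear' : ∀ᶠ p in 𝓝 (extChartAt 𝓘(ℝ, E) x x),
      (extChartAt 𝓘(ℝ, E) x).symm p ∈ (chartAt E x).source ∧ (extChartAt 𝓘(ℝ, E) x).symm p ∈ O :=
    (tendsto_extChartAt_symm hxs).eventually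
      (((chartAt E x).open_source.eventually_mem hxs).and (hO.eventually_mem hx))
  set o := extChartAt 𝓘(ℝ, E) x x with ho
  have hl0 := hl x hx
  have hG : DifferentiableAt ℝ (inChart ℝ x (endComp x t.G)) o :=
    (contDiffAt_inChart hxs (contMDiffAt_endComp hxs
      (hs.G.contMDiffAt (hO.mem_nhds hx)))).differentiableAt (by simp)
  have hc : fderiv ℝ (inChart ℝ x fun y => coords ℝ E x y (ofCoords ℝ E x y c)) o = 0 := by
    have h1 : (inChart ℝ x fun y => coords ℝ E x y (ofCoords ℝ E x y c)) =ᶠ[𝓝 o]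
        fun _ => c := by
      filter_upwards [hnear'] with p hp
      exact coords_ofCoords hp.1 _
    rw [h1.fderiv_eq]
    simp
  have hGU : fderiv ℝ (inChart ℝ x fun y => coords ℝ E x y (t.G y (t.U y))) o = 0 := by
    have h1 : (inChart ℝ x fun y => coords ℝ E x y (t.G y (t.U y))) =ᶠ[𝓝 o]
        fun _ => (0 : E) := by
      filter_upwards [hnear'] with p hp
      simp only [inChart]
      rw [(hl _ hp.2).G_U, map_zero]
    rw [h1.fderiv_eq]
    simp
  have hGc : ∀ a : E, fderiv ℝ
      (inChart ℝ x fun y => coords ℝ E x y (t.G y (ofCoords ℝ E x y c))) o a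
      = fderiv ℝ (inChart ℝ x (endComp x t.G)) o a c := by
    intro a
    have h1 : (inChart ℝ x fun y => coords ℝ E x y (t.G y (ofCoords ℝ E x y c))) =
        fun p : E => inChart ℝ x (endComp x t.G) p c := rfl
    rw [h1, (hG.hasFDerivAt.clm_apply (hasFDerivAt_const c o)).fderiv]
    simp
  have h := hn (fun y => ofCoords ℝ E x y c) (smoothFieldAt_ofCoords hxs contMDiffAt_const)
  have hH : ∀ a : TangentSpace 𝓘(ℝ, E) x, t.H x a = t.G x (J x a) := fun _ => rfl
  have z1 : ∀ a : TangentSpace 𝓘(ℝ, E) x, g.inner x (t.U x) (t.G x a) = 0 := fun a => by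
    rw [hl0.dual, hl0.u_G]
  have z2 : ∀ a : TangentSpace 𝓘(ℝ, E) x, g.inner x (t.U x) (t.H x a) = 0 := fun a => by
    rw [hl0.dual, hH, hl0.u_G]
  have h' := congrArg (coords ℝ E x x) h
  rw [S, nijenhuis] at h'
  simp only [z1, z2, hl0.G_U, hl0.H_U, hl0.v_U (herm x), map_add, map_sub, map_smul, map_zero,
    coords_G, coords_mlieBracket, mul_zero, zero_smul, smul_zero, add_zero, sub_zero, zero_sub,
    sub_self] at h'
  rw [← ho, hc, hGU, hGc] at h'
  simp only [coords_G, coords_ofCoords hxs, hH, coords_J hxs] at h'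
  have hU : inChart ℝ x (vecComp x t.U) o = coords ℝ E x x (t.U x) := inChart_extChartAt hxs _
  have hσ : inChart ℝ x (covComp x t.σ) o (coords ℝ E x x (t.U x)) = t.σ x (t.U x) := by
    rw [inChart_extChartAt hxs, covComp_apply, ofCoords_coords hxs]
  have hv : (fun y => coords ℝ E x y (t.U y)) = vecComp x t.U := rfl
  rw [hv, ← ho] at h'
  rw [hU, hσ, ← h', map_sub]
  simp only [zero_apply, map_zero, neg_zero, sub_zero, zero_sub, add_zero]

end LocalTensors

end Killing

section Killing

variable {E : Type*} [NormedAddCommGroup E] [NormedSpace ℂ E] [FiniteDimensional ℂ E]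
  {M : Type*} [TopologicalSpace M] [ChartedSpace E M] [IsManifold 𝓘(ℂ, E) ∞ M]

namespace LocalTensors

variable {t : LocalTensors E M} {g : SemiRiemannianMetric E M} {x : M}

/-- On horizontal vectors `∇U = -G`: the identity `g(∇_a U, b) = -g(G a, b)`, with the Levi-Civita
derivative in the preferred chart at `x`. Only the part `S(U, ·) = 0` of normality is used. -/
theorem inner_covDeriv_U {O : Set M} (hO : IsOpen O) (hx : x ∈ O) (hs : t.SmoothOn O)
    (hl : ∀ y ∈ O, t.Laws g y)
    (herm : ∀ x a b, g.inner x (J x a) (J x b) = g.inner x a b)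
    (hn : ∀ X : Π x : M, TangentSpace 𝓘(ℝ, E) x, SmoothFieldAt X x → t.S g t.U X x = 0)
    {a b : TangentSpace 𝓘(ℝ, E) x} (ha : t.u x a = 0) (ha' : t.v x a = 0)
    (hb : t.u x b = 0) (hb' : t.v x b = 0) :
    g.inner x (ofCoords ℝ E x x (mvfderiv 𝓘(ℝ, E) (vecComp x t.U) x a)
      + g.christoffel x a (t.U x)) b = -g.inner x (t.G x a) b := by
  have hxs := mem_chart_source E x
  set o := extChartAt 𝓘(ℝ, E) x x with ho
  have hnear : ∀ᶠ p in 𝓝 o, (extChartAt 𝓘(ℝ, E) x).symm p ∈ (chartAt E x).source ∧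
      (extChartAt 𝓘(ℝ, E) x).symm p ∈ O ∧ p ∈ (extChartAt 𝓘(ℝ, E) x).target :=
    ((tendsto_extChartAt_symm hxs).eventually
      (((chartAt E x).open_source.eventually_mem hxs).and (hO.eventually_mem hx))).and
      ((isOpen_extChartAt_target x).eventually_mem (mem_extChartAt_target x)) |>.mono
      fun p hp => ⟨hp.1.1, hp.1.2, hp.2⟩
  have hOx := hO.mem_nhds hx
  have hl0 := hl x hx
  have su : ∀ y ∈ (chartAt E x).source, y ∈ O →
      ContMDiffAt 𝓘(ℝ, E) 𝓘(ℝ, E →L[ℝ] ℝ) ∞ (covComp x t.u) y := fun y hy hyO =>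
    contMDiffAt_covComp hy (hs.u.contMDiffAt (hO.mem_nhds hyO))
  have sU := contMDiffAt_vecComp hxs (hs.U x hx)
  have sG := contMDiffAt_endComp hxs (hs.G.contMDiffAt hOx)
  have sσ := contMDiffAt_covComp hxs (hs.σ.contMDiffAt hOx)
  have hv : ∀ y, ∀ a : TangentSpace 𝓘(ℝ, E) y, t.v y a = t.u y (J y a) := fun _ _ => rfl
  have hH : ∀ y, ∀ a : TangentSpace 𝓘(ℝ, E) y, t.H y a = t.G y (J y a) := fun _ _ => rfl
  -- values of the components at `x`
  have eu : ∀ c, inChart ℝ x (covComp x t.u) o c = t.u x (ofCoords ℝ E x x c) := fun c => by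
    rw [inChart_extChartAt hxs, covComp_apply]
  have eσ : ∀ c, inChart ℝ x (covComp x t.σ) o c = t.σ x (ofCoords ℝ E x x c) := fun c => by
    rw [inChart_extChartAt hxs, covComp_apply]
  have eG : ∀ c, inChart ℝ x (endComp x t.G) o c
      = coords ℝ E x x (t.G x (ofCoords ℝ E x x c)) := fun c => by
    rw [inChart_extChartAt hxs, endComp_apply]
  have eU : inChart ℝ x (vecComp x t.U) o = coords ℝ E x x (t.U x) := inChart_extChartAt hxs _
  have eg : ∀ c d, g.inChart x o c d
      = g.inner x (ofCoords ℝ E x x c) (ofCoords ℝ E x x d) := fun c d => by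
    rw [← g.inChart_coords, coords_ofCoords hxs, coords_ofCoords hxs]
  have eJ : ∀ c : E, (Complex.I • ContinuousLinearMap.id ℝ E) c = Complex.I • c := fun _ => rfl
  have hext := fun (α : Π x : M, TangentSpace 𝓘(ℝ, E) x →L[ℝ] ℝ) (y : M)
    (hy : y ∈ (chartAt E x).source) hα c d =>
    extDeriv_eq_fderiv_inChart (α := α) hy hα (ofCoords ℝ E x y c) (ofCoords ℝ E x y d)
  -- the form `v` in the chart at `x`
  have ev : covComp x t.v =ᶠ[𝓝 x]
      fun y => (covComp x t.u y).comp (Complex.I • ContinuousLinearMap.id ℝ E) := by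
    filter_upwards [(chartAt E x).open_source.eventually_mem hxs] with y hy
    ext c
    rw [covComp_apply, hv, ← ofCoords_I_smul hy]
    rfl
  have sv : ContMDiffAt 𝓘(ℝ, E) 𝓘(ℝ, E →L[ℝ] ℝ) ∞ (covComp x t.v) x :=
    ((su x hxs hx).clm_comp contMDiffAt_const).congr_of_eventuallyEq ev
  have dv : ∀ c d, fderiv ℝ (inChart ℝ x (covComp x t.v)) o c d
      = fderiv ℝ (inChart ℝ x (covComp x t.u)) o c
        ((Complex.I • ContinuousLinearMap.id ℝ E) d) := by
    intro c d
    have h1 : inChart ℝ x (covComp x t.v) =ᶠ[𝓝 o] fun p =>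
        (inChart ℝ x (covComp x t.u) p).comp (Complex.I • ContinuousLinearMap.id ℝ E) :=
      (tendsto_extChartAt_symm hxs).eventually ev
    have h2 := ((contDiffAt_inChart hxs (su x hxs hx)).differentiableAt (by simp)).hasFDerivAt
    rw [h1.fderiv_eq, (h2.clm_comp (hasFDerivAt_const _ o)).fderiv]
    simp
    rfl
  have key := covDeriv_killing_in_chart (o := o) (u := inChart ℝ x (covComp x t.u))
    (σ := inChart ℝ x (covComp x t.σ)) (U := inChart ℝ x (vecComp x t.U))
    (G := inChart ℝ x (endComp x t.G)) (J := Complex.I • ContinuousLinearMap.id ℝ E)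
    (g := g.inChart x) ((contDiffAt_inChart hxs (su x hxs hx)).of_le (WithTop.coe_le_coe.2 le_top))
    ((contDiffAt_inChart hxs sσ).differentiableAt (by simp))
    ((contDiffAt_inChart hxs sU).differentiableAt (by simp))
    ((contDiffAt_inChart hxs sG).differentiableAt (by simp))
    (g.differentiableAt_inChart x)
    (hnear.mono fun p _ c d => g.symm _ _ _)
    (hnear.mono fun p hp c d => by
      simp only [SemiRiemannianMetric.inChart, inChart, bilinComp_apply, endComp_apply,
        ofCoords_coords hp.1]
      exact (hl _ hp.2.1).G_skew _ _)
    (hnear.mono fun p hp c => by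
      simp only [SemiRiemannianMetric.inChart, inChart, bilinComp_apply, covComp_apply, vecComp,
        ofCoords_coords hp.1]
      exact (hl _ hp.2.1).dual _)
    (hnear.mono fun p hp => by
      simp only [inChart, endComp_apply, vecComp, ofCoords_coords hp.1]
      rw [(hl _ hp.2.1).G_U, map_zero])
    (by rw [eu, eU, ofCoords_coords hxs]; exact hl0.u_U)
    (hnear.mono fun p hp => by
      simp only [inChart, covComp_apply, vecComp, eJ, ofCoords_I_smul hp.1, ofCoords_coords hp.1]
      exact (hl _ hp.2.1).v_U (herm _))
    (hnear.mono fun p hp c d => by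
      have h1 := hext t.u _ hp.1 (su _ hp.1 hp.2.1) c d
      rw [(extChartAt 𝓘(ℝ, E) x).right_inv hp.2.2, coords_ofCoords hp.1, coords_ofCoords hp.1,
        (hl _ hp.2.1).ext_u] at h1
      simp only [wedge, hv] at h1
      set z := (extChartAt 𝓘(ℝ, E) x).symm p with hz
      have h2 : inChart ℝ x (covComp x t.u) p ((Complex.I • ContinuousLinearMap.id ℝ E) c)
          = t.u z (J z (ofCoords ℝ E x z c)) := by
        rw [eJ, ← ofCoords_I_smul hp.1]; rfl
      have h3 : inChart ℝ x (covComp x t.u) p ((Complex.I • ContinuousLinearMap.id ℝ E) d)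
          = t.u z (J z (ofCoords ℝ E x z d)) := by
        rw [eJ, ← ofCoords_I_smul hp.1]; rfl
      have h4 : g.inChart x p c (inChart ℝ x (endComp x t.G) p d)
          = g.inner z (ofCoords ℝ E x z c) (t.G z (ofCoords ℝ E x z d)) := by
        change g.inner z (ofCoords ℝ E x z c)
          (ofCoords ℝ E x z (coords ℝ E x z (t.G z (ofCoords ℝ E x z d)))) = _
        rw [ofCoords_coords hp.1]
      have h5 : ∀ c, inChart ℝ x (covComp x t.σ) p c = t.σ z (ofCoords ℝ E x z c) := fun _ => rfl
      rw [h2, h3, h4, h5, h5]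
      linarith)
    (fun c d => by
      have h1 := hext t.v x hxs sv c d
      rw [coords_ofCoords hxs, coords_ofCoords hxs, hl0.ext_v, ← ho, dv, dv, eJ, eJ] at h1
      simp only [wedge, hH] at h1
      rw [eg, eG, eσ, eσ, eu, eu, ofCoords_coords hxs, eJ, eJ, ofCoords_I_smul hxs]
      linarith)
    (fun c => by
      have h1 := congrArg (coords ℝ E x x) (hl0.G_sq (ofCoords ℝ E x x c))
      have h2 : t.V x = -J x (t.U x) := rfl
      rw [h2, hv] at h1
      simp only [map_add, map_neg, map_smul, coords_ofCoords hxs, coords_J hxs] at h1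
      rw [eG, eG, ofCoords_coords hxs, h1, eu, eU, eu, eJ, eJ, ofCoords_I_smul hxs, smul_neg,
        sub_eq_add_neg])
    (fun c => by
      rw [eG, eG, eJ, eJ, ofCoords_I_smul hxs, hl0.G_J, map_neg, coords_J hxs])
    (fun c => by
      have := S_U_in_chart hO hx hs hl herm hn ho c
      simpa using this)
    (a := coords ℝ E x x a) (b := coords ℝ E x x b)
    (by rw [eu, ofCoords_coords hxs, ha])
    (by rw [eJ, eu, ofCoords_I_smul hxs, ofCoords_coords hxs]; exact ha')
    (by rw [eu, ofCoords_coords hxs, hb])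
    (by rw [eJ, eu, ofCoords_I_smul hxs, ofCoords_coords hxs]; exact hb')
  rw [map_add, add_apply, g.inner_christoffel, g.koszul_apply,
    mvfderiv_eq_fderiv_inChart hxs sU]
  rw [eg, ofCoords_coords hxs, eU, eg, eG, ofCoords_coords hxs, ofCoords_coords hxs,
    ofCoords_coords hxs] at key
  exact key

end LocalTensors

end Killing

/-! ### Vector fields along an immersion -/

section Along

variable {E : Type*} [NormedAddCommGroup E] [NormedSpace ℝ E]
  {M : Type*} [TopologicalSpace M] [ChartedSpace E M] [IsManifold 𝓘(ℝ, E) ∞ M]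
  {F : Type*} [NormedAddCommGroup F] [NormedSpace ℝ F]
  {N : Type*} [TopologicalSpace N] [ChartedSpace F N] [IsManifold 𝓘(ℝ, F) ∞ N]
  {g : SemiRiemannianMetric E M} {f : N → M}

/-- The components, in the preferred chart at `f p`, of a vector field along `f`. -/
def alongComp (f : N → M) (p : N) (Z : Π q : N, TangentSpace 𝓘(ℝ, E) (f q)) (q : N) : E :=
  coords ℝ E (f p) (f q) (Z q)

/-- The differential of `f` in the preferred charts at `p` and `f p`. -/
def diffComp (f : N → M) (p q : N) : F →L[ℝ] E :=
  (coords ℝ E (f p) (f q)).comp ((diff (E := E) (F := F) f q).comp (ofCoords ℝ F p q))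

theorem contMDiffAt_diffComp {p : N} (hf : ContMDiffAt 𝓘(ℝ, F) 𝓘(ℝ, E) ∞ f p) :
    ContMDiffAt 𝓘(ℝ, F) 𝓘(ℝ, F →L[ℝ] E) ∞ (diffComp (E := E) (F := F) f p) p :=
  ContMDiffAt.mfderiv_const hf (m := ∞) (by simp)

theorem eventually_mem_source {p : N} (hf : ContMDiffAt 𝓘(ℝ, F) 𝓘(ℝ, E) ∞ f p) :
    ∀ᶠ q in 𝓝 p, q ∈ (chartAt F p).source ∧ f q ∈ (chartAt E (f p)).source :=
  ((chartAt F p).open_source.eventually_mem (mem_chart_source F p)).and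
    (hf.continuousAt.eventually
      ((chartAt E (f p)).open_source.eventually_mem (mem_chart_source E (f p))))

theorem alongComp_diff {p q : N} (hq : q ∈ (chartAt F p).source)
    (Y : Π q : N, TangentSpace 𝓘(ℝ, F) q) :
    alongComp (E := E) f p (fun q => diff f q (Y q)) q
      = diffComp (E := E) f p q (vecComp p Y q) := by
  simp only [alongComp, diffComp, vecComp, ContinuousLinearMap.comp_apply]
  rw [ofCoords_coords hq]

theorem contMDiffAt_alongComp_diff {p : N} (hf : ContMDiffAt 𝓘(ℝ, F) 𝓘(ℝ, E) ∞ f p)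
    {Y : Π q : N, TangentSpace 𝓘(ℝ, F) q} (hY : SmoothFieldAt Y p) :
    ContMDiffAt 𝓘(ℝ, F) 𝓘(ℝ, E) ∞ (alongComp (E := E) f p fun q => diff f q (Y q)) p := by
  refine ((contMDiffAt_diffComp hf).clm_apply
    (contMDiffAt_vecComp (mem_chart_source F p) hY)).congr_of_eventuallyEq ?_
  filter_upwards [eventually_mem_source hf] with q hq
  exact alongComp_diff hq.1 Y

theorem contMDiffAt_alongComp {p : N} (hf : ContMDiffAt 𝓘(ℝ, F) 𝓘(ℝ, E) ∞ f p)
    {Z : Π q : N, TangentSpace 𝓘(ℝ, E) (f q)}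
    (hZ : ContMDiffAt 𝓘(ℝ, F) 𝓘(ℝ, E).tangent ∞
      (fun q => (⟨f q, Z q⟩ : TangentBundle 𝓘(ℝ, E) M)) p) :
    ContMDiffAt 𝓘(ℝ, F) 𝓘(ℝ, E) ∞ (alongComp f p Z) p := by
  refine (Bundle.contMDiffAt_totalSpace.1 hZ).2.congr_of_eventuallyEq ?_
  filter_upwards [eventually_mem_source hf] with q hq
  rw [alongComp, coords, Bundle.Trivialization.continuousLinearMapAt_apply,
    Bundle.Trivialization.coe_linearMapAt_of_mem _ (by simpa using hq.2)]

/-- A field on the source of an immersion is smooth if its image is the restriction of a smooth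
field: near `p` it is obtained from that field by a left inverse of `df` that depends smoothly on
the point. -/
theorem smoothFieldAt_of_diff_eq [FiniteDimensional ℝ E] [FiniteDimensional ℝ F] {p : N}
    (hf : ContMDiffAt 𝓘(ℝ, F) 𝓘(ℝ, E) ∞ f p)
    (hi : Function.Injective (diff (E := E) (F := F) f p))
    {X : Π x : M, TangentSpace 𝓘(ℝ, E) x} (hX : SmoothFieldAt X (f p))
    {Y : Π q : N, TangentSpace 𝓘(ℝ, F) q} (hY : ∀ᶠ q in 𝓝 p, diff f q (Y q) = X (f q)) :
    SmoothFieldAt Y p := by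
  have hps := mem_chart_source F p
  have hfps := mem_chart_source E (f p)
  have hA := contMDiffAt_diffComp hf
  have hAi : Function.Injective (diffComp (E := E) (F := F) f p p) := by
    intro a b hab
    have h1 : Function.Injective (ofCoords ℝ F p p) :=
      Function.LeftInverse.injective (coords_ofCoords (𝕜 := ℝ) hps)
    have h2 : Function.Injective (coords ℝ E (f p) (f p)) :=
      Function.LeftInverse.injective (ofCoords_coords (𝕜 := ℝ) hfps)
    exact h1 (hi (h2 hab))
  obtain ⟨L, hL⟩ := (diffComp (E := E) (F := F) f p p).toLinearMap.exists_leftInverse_of_injective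
    (LinearMap.ker_eq_bot.2 hAi)
  set L' : E →L[ℝ] F := L.toContinuousLinearMap with hL'
  have hLA : L'.comp (diffComp (E := E) (F := F) f p p) = 1 := by
    ext a
    exact LinearMap.congr_fun hL a
  -- near `p` the differential composed with a left inverse at `p` is invertible
  have hB : ContMDiffAt 𝓘(ℝ, F) 𝓘(ℝ, F →L[ℝ] F) ∞
      (fun q => L'.comp (diffComp (E := E) (F := F) f p q)) p :=
    contMDiffAt_const.clm_comp hA
  have hinv : ContMDiffAt 𝓘(ℝ, F) 𝓘(ℝ, F →L[ℝ] F) ∞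
      (fun q => Ring.inverse (L'.comp (diffComp (E := E) (F := F) f p q))) p := by
    have h1 : ContDiffAt ℝ ∞ (Ring.inverse : (F →L[ℝ] F) → _)
        (L'.comp (diffComp (E := E) (F := F) f p p)) := by
      rw [hLA]
      have : CompleteSpace F := FiniteDimensional.complete ℝ F
      exact contDiffAt_ringInverse ℝ (1 : (F →L[ℝ] F)ˣ)
    exact h1.contMDiffAt.comp p hB
  have hunit : ∀ᶠ q in 𝓝 p, IsUnit (L'.comp (diffComp (E := E) (F := F) f p q)) := by
    have : CompleteSpace F := FiniteDimensional.complete ℝ F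
    refine hB.continuousAt.eventually (Units.isOpen.mem_nhds ?_)
    change IsUnit (L'.comp (diffComp (E := E) (F := F) f p p))
    rw [hLA]
    exact isUnit_one
  have hXf : ContMDiffAt 𝓘(ℝ, F) 𝓘(ℝ, E) ∞ (fun q => vecComp (f p) X (f q)) p :=
    (contMDiffAt_vecComp hfps hX).comp p hf
  rw [smoothFieldAt_iff_of_mem hps]
  refine (hinv.clm_apply ((contMDiffAt_const (c := L')).clm_apply hXf)).congr_of_eventuallyEq ?_
  filter_upwards [hY, hunit, eventually_mem_source hf] with q hq hq1 hq2
  have h1 := alongComp_diff (E := E) (f := f) hq2.1 Y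
  have h2 : alongComp (E := E) f p (fun q => diff f q (Y q)) q = vecComp (f p) X (f q) := by
    simp only [alongComp, vecComp, hq]
  rw [← h2, h1]
  have h3 := Ring.inverse_mul_cancel _ hq1
  exact (DFunLike.congr_fun h3 (vecComp p Y q)).symm

section Connection

variable [FiniteDimensional ℝ E]

/-- The Levi-Civita derivative along `f`, paired with a vector, in terms of the Koszul form. -/
theorem inner_covDeriv (Z : Π q : N, TangentSpace 𝓘(ℝ, E) (f q)) (p : N)
    (w : TangentSpace 𝓘(ℝ, F) p) (c : TangentSpace 𝓘(ℝ, E) (f p)) :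
    g.inner (f p) (covDeriv g f Z p w) c
      = g.inner (f p) (ofCoords ℝ E (f p) (f p) (mvfderiv 𝓘(ℝ, F) (alongComp f p Z) p w)) c
        + (1 / 2) * g.koszul (f p) (diff f p w) (Z p) c := by
  rw [covDeriv, map_add, add_apply, g.inner_christoffel]
  rfl

theorem covDeriv_congr {Z Z' : Π q : N, TangentSpace 𝓘(ℝ, E) (f q)} {p : N}
    (h : ∀ᶠ q in 𝓝 p, Z q = Z' q) (w : TangentSpace 𝓘(ℝ, F) p) :
    covDeriv g f Z p w = covDeriv g f Z' p w := by
  have h1 : (fun q => coords ℝ E (f p) (f q) (Z q)) =ᶠ[𝓝 p]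
      fun q => coords ℝ E (f p) (f q) (Z' q) := h.mono fun q hq => by
    simp only [hq]
  have h2 := DFunLike.congr_fun (mvfderiv_congr (𝕜 := ℝ) (E := F) h1) w
  have h3 : mvfderiv 𝓘(ℝ, F) (fun q => coords ℝ E (f p) (f q) (Z q)) p w
    = mvfderiv 𝓘(ℝ, F) (fun q => coords ℝ E (f p) (f q) (Z' q)) p w := h2
  rw [covDeriv, covDeriv, h3, h.self_of_nhds]

/-- The derivative along `f` of the restriction of an ambient field `X` is the ambient derivative
of `X` in the direction `df w`. -/
theorem covDeriv_comp {p : N} (hf : ContMDiffAt 𝓘(ℝ, F) 𝓘(ℝ, E) ∞ f p)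
    {X : Π x : M, TangentSpace 𝓘(ℝ, E) x} (hX : SmoothFieldAt X (f p))
    (w : TangentSpace 𝓘(ℝ, F) p) :
    covDeriv g f (fun q => X (f q)) p w
      = ofCoords ℝ E (f p) (f p) (mvfderiv 𝓘(ℝ, E) (vecComp (f p) X) (f p) (diff f p w))
        + g.christoffel (f p) (diff f p w) (X (f p)) := by
  have h1 := mfderiv_comp_apply (I := 𝓘(ℝ, F)) (I' := 𝓘(ℝ, E)) (I'' := 𝓘(ℝ, E)) p
    ((contMDiffAt_vecComp (mem_chart_source E (f p)) hX).mdifferentiableAt (by simp))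
    (hf.mdifferentiableAt (by simp)) w
  have h2 : mvfderiv 𝓘(ℝ, F) (fun q => coords ℝ E (f p) (f q) (X (f q))) p w
    = mvfderiv 𝓘(ℝ, E) (vecComp (f p) X) (f p) (diff f p w) := h1
  rw [covDeriv, h2]

/-- The Levi-Civita derivative is compatible with the metric: `2 g(∇_w Z, Z) = w(g(Z, Z))`. -/
theorem two_inner_covDeriv_self {p : N} (hf : ContMDiffAt 𝓘(ℝ, F) 𝓘(ℝ, E) ∞ f p)
    {Z : Π q : N, TangentSpace 𝓘(ℝ, E) (f q)}
    (hZ : ContMDiffAt 𝓘(ℝ, F) 𝓘(ℝ, E) ∞ (alongComp f p Z) p) (w : TangentSpace 𝓘(ℝ, F) p) :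
    2 * g.inner (f p) (covDeriv g f Z p w) (Z p)
      = mvfderiv 𝓘(ℝ, F) (fun q => g.inner (f q) (Z q) (Z q)) p w := by
  have hps := mem_chart_source F p
  have hfps := mem_chart_source E (f p)
  have hb := g.contMDiffAt_bilinComp hfps
  have hγ : ContMDiffAt 𝓘(ℝ, F) 𝓘(ℝ, E →L[ℝ] E →L[ℝ] ℝ) ∞
      (fun q => bilinComp (f p) g.inner (f q)) p := hb.comp p hf
  have h1 : (fun q => g.inner (f q) (Z q) (Z q)) =ᶠ[𝓝 p] fun q =>
      bilinComp (f p) g.inner (f q) (alongComp f p Z q) (alongComp f p Z q) := by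
    filter_upwards [eventually_mem_source hf] with q hq
    rw [bilinComp_apply, alongComp, ofCoords_coords hq.2]
  have h2 : mvfderiv 𝓘(ℝ, F) (fun q => g.inner (f q) (Z q) (Z q)) p w = mvfderiv 𝓘(ℝ, F) (fun q =>
      bilinComp (f p) g.inner (f q) (alongComp f p Z q) (alongComp f p Z q)) p w :=
    DFunLike.congr_fun (mvfderiv_congr (𝕜 := ℝ) (E := F) h1) w
  have h3 := ((((contDiffAt_inChart hps hγ).differentiableAt (by simp)).hasFDerivAt.clm_apply
    ((contDiffAt_inChart hps hZ).differentiableAt (by simp)).hasFDerivAt).clm_apply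
    ((contDiffAt_inChart hps hZ).differentiableAt (by simp)).hasFDerivAt).fderiv
  have h4 : mvfderiv 𝓘(ℝ, F) (fun q => bilinComp (f p) g.inner (f q)) p w
      = fderiv ℝ (g.inChart (f p)) (extChartAt 𝓘(ℝ, E) (f p) (f p))
        (coords ℝ E (f p) (f p) (diff f p w)) := by
    have h5 := mfderiv_comp_apply (I := 𝓘(ℝ, F)) (I' := 𝓘(ℝ, E))
      (I'' := 𝓘(ℝ, E →L[ℝ] E →L[ℝ] ℝ)) p (hb.mdifferentiableAt (by simp))
      (hf.mdifferentiableAt (by simp)) w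
    refine Eq.trans h5 ?_
    exact mvfderiv_eq_fderiv_inChart hfps hb _
  have h6 : alongComp f p Z p = coords ℝ E (f p) (f p) (Z p) := rfl
  have h7 : mvfderiv 𝓘(ℝ, F) (fun q =>
      bilinComp (f p) g.inner (f q) (alongComp f p Z q) (alongComp f p Z q)) p w
    = mvfderiv 𝓘(ℝ, F) (fun q => bilinComp (f p) g.inner (f q)) p w (alongComp f p Z p)
        (alongComp f p Z p)
      + bilinComp (f p) g.inner (f p) (mvfderiv 𝓘(ℝ, F) (alongComp f p Z) p w) (alongComp f p Z p)
      + bilinComp (f p) g.inner (f p) (alongComp f p Z p)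
        (mvfderiv 𝓘(ℝ, F) (alongComp f p Z) p w) := by
    rw [mvfderiv_eq_fderiv_inChart hps ((hγ.clm_apply hZ).clm_apply hZ),
      mvfderiv_eq_fderiv_inChart hps hγ, mvfderiv_eq_fderiv_inChart hps hZ]
    refine (DFunLike.congr_fun h3 _).trans ?_
    simp only [add_apply, ContinuousLinearMap.comp_apply, ContinuousLinearMap.flip_apply]
    rw [inChart_extChartAt hps, inChart_extChartAt hps]
    ring
  rw [h2, h7, h4, h6, inner_covDeriv, g.koszul_apply, bilinComp_apply, bilinComp_apply,
    ofCoords_coords hfps, g.symm _ (Z p)]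
  ring

end Connection

end Along

/-! ### The normal line and the screen projection -/

section NullHypersurface

variable {E : Type*} [NormedAddCommGroup E] [NormedSpace ℝ E]
  {M : Type*} [TopologicalSpace M] [ChartedSpace E M] [IsManifold 𝓘(ℝ, E) ∞ M]
  {F : Type*} [NormedAddCommGroup F] [NormedSpace ℝ F]
  {N : Type*} [TopologicalSpace N] [ChartedSpace F N] [IsManifold 𝓘(ℝ, F) ∞ N]
  {g : SemiRiemannianMetric E M} {f : N → M}

/-- The normal line is tangent to a null hypersurface and spanned there by any nonzero `ξ`. -/
theorem IsNullHypersurface.exists_smul_eq (hf : IsNullHypersurface F g f) {p : N}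
    {ξ : TangentSpace 𝓘(ℝ, F) p} (hξ : ξ ∈ radical F g f p) (hξ0 : ξ ≠ 0)
    {a : TangentSpace 𝓘(ℝ, E) (f p)} (ha : a ∈ normalSpace F g f p) :
    ∃ c : ℝ, a = c • diff f p ξ := by
  have h0 : (⟨diff f p ξ, hξ⟩ : normalSpace F g f p) ≠ 0 := by
    intro h
    apply hξ0
    apply hf.immersion p
    rw [map_zero]
    exact congrArg Subtype.val h
  obtain ⟨c, hc⟩ := (finrank_eq_one_iff_of_nonzero' _ h0).1 (hf.rank_normal p) ⟨a, ha⟩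
  exact ⟨c, (congrArg Subtype.val hc).symm⟩

variable {S : ScreenDistribution F g f} {W : Set N} {ξ : Π p : N, TangentSpace 𝓘(ℝ, F) p}
  {η : Π p : N, TangentSpace 𝓘(ℝ, E) (f p)}

theorem ScreenDistribution.proj_eq_self {Y : Π p : N, TangentSpace 𝓘(ℝ, F) p} {p : N}
    (h : Y p ∈ S.space p) : S.proj Y p = Y p :=
  Submodule.projection_apply_of_mem_left _ h

/-- The screen projection in terms of a null frame: `PY = Y - g(Y, η) ξ`. -/
theorem IsNullFrame.proj_eq (hf : IsNullHypersurface F g f) (hW : IsNullFrame g f S W ξ η)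
    (Y : Π p : N, TangentSpace 𝓘(ℝ, F) p) {p : N} (hp : p ∈ W) :
    S.proj Y p = Y p - g.inner (f p) (diff f p (Y p)) (η p) • ξ p := by
  have h1 : S.proj Y p ∈ S.space p := Submodule.projection_apply_mem _ _
  have h2 : Y p - S.proj Y p ∈ radical F g f p := Submodule.sub_projection_mem _ _
  obtain ⟨c, hc⟩ := hf.exists_smul_eq (hW.mem_radical p hp) (hW.ne_zero p hp) h2
  have hc' : Y p - S.proj Y p = c • ξ p := by
    apply hf.immersion p
    rw [map_smul]
    exact hc
  have h3 : g.inner (f p) (diff f p (Y p)) (η p) = c := by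
    have h4 : Y p = S.proj Y p + c • ξ p := by rw [← hc']; abel
    rw [h4, map_add, map_add, add_apply, g.symm, hW.orthogonal p hp _ h1, map_smul, map_smul,
      smul_apply, hW.pairing p hp]
    simp
  rw [h3, ← hc']
  abel

variable [FiniteDimensional ℝ E]

/-- `B(X, PY) = B(X, Y)`: the two fields differ by a multiple of `ξ`, and `g(∇̄_X ξ, ξ) = 0`
because `ξ` is a null field. -/
theorem IsNullFrame.secondForm_proj (hf : IsNullHypersurface F g f)
    (hW : IsNullFrame g f S W ξ η) (X : Π p : N, TangentSpace 𝓘(ℝ, F) p)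
    {Y : Π p : N, TangentSpace 𝓘(ℝ, F) p} {p : N} (hp : p ∈ W) (hY : SmoothFieldAt Y p) :
    secondForm g f ξ X (S.proj Y) p = secondForm g f ξ X Y p := by
  have hfp := hf.smooth p
  have hfps := mem_chart_source E (f p)
  have hWp := hW.isOpen.mem_nhds hp
  have hz := contMDiffAt_alongComp_diff hfp hY
  have hr := contMDiffAt_alongComp_diff hfp (hW.smooth_normal p hp)
  have hη := contMDiffAt_alongComp hfp (hW.smooth_transversal.contMDiffAt hWp)
  -- `PY = Y - l ξ`
  set l : N → ℝ := fun q => g.inner (f q) (diff f q (Y q)) (η q) with hl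
  have hγ : ContMDiffAt 𝓘(ℝ, F) 𝓘(ℝ, E →L[ℝ] E →L[ℝ] ℝ) ∞
      (fun q => bilinComp (f p) g.inner (f q)) p := (g.contMDiffAt_bilinComp hfps).comp p hfp
  have hls : ContMDiffAt 𝓘(ℝ, F) 𝓘(ℝ, ℝ) ∞ l p := by
    refine ((hγ.clm_apply hz).clm_apply hη).congr_of_eventuallyEq ?_
    filter_upwards [eventually_mem_source hfp] with q hq
    rw [bilinComp_apply, alongComp, alongComp, ofCoords_coords hq.2, ofCoords_coords hq.2]
  have hnull : ∀ q ∈ W, g.inner (f q) (diff f q (ξ q)) (diff f q (ξ q)) = 0 :=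
    fun q hq => hW.mem_radical q hq (ξ q)
  -- `ξ` is a null field, so `g(∇̄ ξ, ξ) = 0`
  have hxi : g.inner (f p) (covDeriv g f (fun q => diff f q (ξ q)) p (X p)) (diff f p (ξ p)) = 0 := by
    have h1 := two_inner_covDeriv_self (g := g) hfp hr (X p)
    have h2 : (fun q => g.inner (f q) (diff f q (ξ q)) (diff f q (ξ q))) =ᶠ[𝓝 p] fun _ => 0 := by
      filter_upwards [hWp] with q hq using hnull q hq
    have h3 : mvfderiv 𝓘(ℝ, F) (fun q => g.inner (f q) (diff f q (ξ q)) (diff f q (ξ q))) p (X p)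
        = mvfderiv 𝓘(ℝ, F) (fun _ : N => (0 : ℝ)) p (X p) :=
      DFunLike.congr_fun (mvfderiv_congr (𝕜 := ℝ) (E := F) h2) (X p)
    rw [h3, mvfderiv_const] at h1
    simpa using h1
  have hproj : ∀ q ∈ W, S.proj Y q = Y q - l q • ξ q := fun q hq => hW.proj_eq hf Y hq
  have hcomp : alongComp (E := E) f p (fun q => diff f q (S.proj Y q)) =ᶠ[𝓝 p]
      fun q => alongComp (E := E) f p (fun q => diff f q (Y q)) q
        - l q • alongComp (E := E) f p (fun q => diff f q (ξ q)) q := by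
    filter_upwards [hWp] with q hq
    have h1 : alongComp (E := E) f p (fun q => diff f q (S.proj Y q)) q
      = coords ℝ E (f p) (f q) (diff f q (S.proj Y q)) := rfl
    rw [h1, hproj q hq, map_sub, map_smul, map_sub, map_smul]
    rfl
  have hd : mvfderiv 𝓘(ℝ, F) (alongComp (E := E) f p fun q => diff f q (S.proj Y q)) p (X p)
      = mvfderiv 𝓘(ℝ, F) (alongComp (E := E) f p fun q => diff f q (Y q)) p (X p)
        - (l p • mvfderiv 𝓘(ℝ, F) (alongComp (E := E) f p fun q => diff f q (ξ q)) p (X p)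
          + mvfderiv 𝓘(ℝ, F) l p (X p) • coords ℝ E (f p) (f p) (diff f p (ξ p))) := by
    have h1 := DFunLike.congr_fun (mvfderiv_congr (𝕜 := ℝ) (E := F) hcomp) (X p)
    refine Eq.trans h1 ?_
    have hl' := hls.mdifferentiableAt (by simp)
    have hr' := hr.mdifferentiableAt (by simp)
    have h2 := mvfderiv_fun_sub (hz.mdifferentiableAt (by simp)) (hl'.smul hr')
    refine (DFunLike.congr_fun h2 (X p)).trans ?_
    have h3 := mvfderiv_smul hl' hr'
    have h4 := DFunLike.congr_fun h3 (X p)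
    rw [sub_apply]
    refine congrArg _ (h4.trans ?_)
    rfl
  have hk : ∀ a b b' c : TangentSpace 𝓘(ℝ, E) (f p), ∀ s : ℝ,
      g.koszul (f p) a (b - s • b') c = g.koszul (f p) a b c - s * g.koszul (f p) a b' c := by
    intro a b b' c s
    simp only [g.koszul_apply, map_sub, map_smul, sub_apply, smul_apply, smul_eq_mul]
    ring
  have hin : ∀ (a b : E) (r s : ℝ) (c d : TangentSpace 𝓘(ℝ, E) (f p)),
      g.inner (f p) (ofCoords ℝ E (f p) (f p) (a - (s • b + r • coords ℝ E (f p) (f p) c))) d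
        = g.inner (f p) (ofCoords ℝ E (f p) (f p) a) d
          - (s * g.inner (f p) (ofCoords ℝ E (f p) (f p) b) d + r * g.inner (f p) c d) := by
    intro a b r s c d
    simp only [map_sub, map_add, map_smul, sub_apply, add_apply, smul_apply, smul_eq_mul,
      ofCoords_coords hfps]
  have hdp : diff (E := E) f p (S.proj Y p) = diff f p (Y p) - l p • diff f p (ξ p) := by
    rw [hproj p hp, map_sub, map_smul]
  rw [secondForm, secondForm, inner_covDeriv, inner_covDeriv, hd, hdp, hin, hk, hnull p hp]
  rw [inner_covDeriv] at hxi
  linear_combination -l p * hxi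

end NullHypersurface

/-! ### Null hypersurfaces tangent to the characteristic subbundle -/

section CharacteristicField

variable {E : Type*} [NormedAddCommGroup E] [NormedSpace ℂ E] [FiniteDimensional ℂ E]
  {M : Type*} [TopologicalSpace M] [ChartedSpace E M] [IsManifold 𝓘(ℂ, E) ∞ M]
  {n : ℕ} {A : Type*} {K : ComplexContactMetricStructure n A E M}
  {F : Type*} [NormedAddCommGroup F] [NormedSpace ℝ F]
  {N : Type*} [TopologicalSpace N] [ChartedSpace F N] [IsManifold 𝓘(ℝ, F) ∞ N]
  {f : N → M} {i : A} {p : N}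

theorem ComplexContactMetricStructure.U_mem_characteristic {x : M} (hx : x ∈ K.O i) :
    (K.t i).U x ∈ K.characteristic x :=
  Submodule.mem_iSup_of_mem i (Submodule.mem_iSup_of_mem hx (Submodule.subset_span (by simp)))

theorem ComplexContactMetricStructure.V_mem_characteristic {x : M} (hx : x ∈ K.O i) :
    (K.t i).V x ∈ K.characteristic x :=
  Submodule.mem_iSup_of_mem i (Submodule.mem_iSup_of_mem hx (Submodule.subset_span (by simp)))

theorem IsNullHypersurface.finiteDimensional (hf : IsNullHypersurface F K.g f) :
    FiniteDimensional ℝ F := by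
  apply FiniteDimensional.of_finrank_pos
  have h1 := hf.codim
  have h2 := finrank_real_of_complex E
  have h3 := K.dim
  omega

theorem inner_eq_zero_of_mem_radical {ξ : TangentSpace 𝓘(ℝ, F) p}
    (hξ : ξ ∈ radical F K.g f p) {a : TangentSpace 𝓘(ℝ, E) (f p)}
    (ha : a ∈ LinearMap.range (diff (E := E) (F := F) f p).toLinearMap) :
    K.g.inner (f p) a (diff f p ξ) = 0 := by
  obtain ⟨w, rfl⟩ := ha
  exact hξ w

/-- Horizontal vectors are those orthogonal to `U` and `V`. -/
theorem horizontal_of_orthogonal (hp : f p ∈ K.O i) {a : TangentSpace 𝓘(ℝ, E) (f p)}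
    (h : ∀ c ∈ K.characteristic (f p), K.g.inner (f p) c a = 0) :
    (K.t i).u (f p) a = 0 ∧ (K.t i).v (f p) a = 0 := by
  have hl := K.laws i (f p) hp
  rw [← hl.dual, ← hl.inner_V (K.hermitian (f p))]
  exact ⟨h _ (K.U_mem_characteristic hp), h _ (K.V_mem_characteristic hp)⟩

/-- The common step of the three non-existence results: if `g(∇̄_w U, Z) = 0` for a fixed
horizontal `Z` and all horizontal tangent vectors `w`, then `G Z` is normal to the hypersurface,
hence a multiple of `ξ`. Indeed `g(w, G Z) = -g(G w, Z) = g(∇̄_w U, Z)` for horizontal `w`, and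
`G` kills `U` and `V`, which are tangent to the hypersurface. -/
theorem exists_G_eq_smul (hnormal : K.IsNormal) (hf : IsNullHypersurface F K.g f)
    (htangent : K.characteristic (f p) ≤
      LinearMap.range (diff (E := E) (F := F) f p).toLinearMap)
    (hp : f p ∈ K.O i) {ξ : TangentSpace 𝓘(ℝ, F) p} (hξ : ξ ∈ radical F K.g f p) (hξ0 : ξ ≠ 0)
    {Z : TangentSpace 𝓘(ℝ, E) (f p)} (hZ : (K.t i).u (f p) Z = 0 ∧ (K.t i).v (f p) Z = 0)
    (h : ∀ w : TangentSpace 𝓘(ℝ, F) p, (K.t i).u (f p) (diff f p w) = 0 →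
      K.g.inner (f p) (covDeriv K.g f (fun q => (K.t i).U (f q)) p w) Z = 0) :
    ∃ c : ℝ, (K.t i).G (f p) Z = c • diff f p ξ := by
  refine hf.exists_smul_eq hξ hξ0 fun w => ?_
  have hl := K.laws i (f p) hp
  have herm := K.hermitian (f p)
  obtain ⟨wU, hwU⟩ := htangent (K.U_mem_characteristic hp)
  obtain ⟨wV, hwV⟩ := htangent (K.V_mem_characteristic hp)
  have hwU' : diff (E := E) f p wU = (K.t i).U (f p) := hwU
  have hwV' : diff (E := E) f p wV = (K.t i).V (f p) := hwV
  have hvU := hl.v_U herm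
  have huV : (K.t i).u (f p) ((K.t i).V (f p)) = 0 := by
    rw [← hl.dual, K.g.symm, hl.inner_V herm, hvU]
  have hvV : (K.t i).v (f p) ((K.t i).V (f p)) = 1 := by
    have h1 : (K.t i).v (f p) ((K.t i).V (f p))
      = (K.t i).u (f p) (J (f p) (-J (f p) ((K.t i).U (f p)))) := rfl
    rw [h1, map_neg, J_J, neg_neg, hl.u_U]
  -- the horizontal part of `df w` is tangent to the hypersurface
  set r := (K.t i).u (f p) (diff f p w) with hr
  set s := (K.t i).v (f p) (diff f p w) with hs
  have hd : diff f p (w - r • wU - s • wV)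
      = diff f p w - r • (K.t i).U (f p) - s • (K.t i).V (f p) := by
    rw [map_sub, map_sub, map_smul, map_smul, hwU', hwV']
  have hu : (K.t i).u (f p) (diff f p (w - r • wU - s • wV)) = 0 := by
    rw [hd, map_sub, map_sub, map_smul, map_smul, hl.u_U, huV, ← hr]
    simp
  have hv : (K.t i).v (f p) (diff f p (w - r • wU - s • wV)) = 0 := by
    rw [hd, map_sub, map_sub, map_smul, map_smul, hvU, hvV, ← hs]
    simp
  have h1 := h _ hu
  rw [covDeriv_comp (hf.smooth p) ((K.smooth i).U _ hp),
    LocalTensors.inner_covDeriv_U (K.isOpen i) hp (K.smooth i) (K.laws i) K.hermitian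
      (fun X hX => ((hnormal i _ hp).2 X hX).1) hu hv hZ.1 hZ.2] at h1
  have hG : (K.t i).G (f p) (diff f p (w - r • wU - s • wV)) = (K.t i).G (f p) (diff f p w) := by
    rw [hd]
    simp only [map_sub, map_smul, hl.G_U, hl.G_V, smul_zero, sub_zero]
  rw [hG, hl.G_skew, neg_neg] at h1
  exact h1

/-- Near `p` the characteristic field `U` restricts to a smooth field `Y` on the hypersurface.
Points outside the domain of `U` get arbitrary values. -/
theorem exists_smoothFieldAt_diff_eq_U (hf : IsNullHypersurface F K.g f)
    (htangent : ∀ p : N, K.characteristic (f p) ≤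
      LinearMap.range (diff (E := E) (F := F) f p).toLinearMap) (hp : f p ∈ K.O i) :
    ∃ Y : Π q : N, TangentSpace 𝓘(ℝ, F) q, SmoothFieldAt Y p ∧
      ∀ᶠ q in 𝓝 p, f q ∈ K.O i ∧ diff f q (Y q) = (K.t i).U (f q) := by
  classical
  have := hf.finiteDimensional
  have h1 : ∀ q, ∃ y : TangentSpace 𝓘(ℝ, F) q, f q ∈ K.O i → diff f q y = (K.t i).U (f q) := by
    intro q
    by_cases hq : f q ∈ K.O i
    · obtain ⟨y, hy⟩ := htangent q (K.U_mem_characteristic hq)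
      exact ⟨y, fun _ => hy⟩
    · exact ⟨0, fun h => absurd h hq⟩
  choose Y hY using h1
  have hnear : ∀ᶠ q in 𝓝 p, f q ∈ K.O i :=
    (hf.smooth p).continuousAt.eventually ((K.isOpen i).eventually_mem hp)
  exact ⟨Y, smoothFieldAt_of_diff_eq (hf.smooth p) (hf.immersion p) ((K.smooth i).U _ hp)
    (hnear.mono hY), hnear.mono fun q hq => ⟨hq, hY q hq⟩⟩

theorem secondForm_eq_of_diff_eq {ξ X Y : Π p : N, TangentSpace 𝓘(ℝ, F) p}
    (hY : ∀ᶠ q in 𝓝 p, diff f q (Y q) = (K.t i).U (f q)) :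
    secondForm K.g f ξ X Y p
      = K.g.inner (f p) (covDeriv K.g f (fun q => (K.t i).U (f q)) p (X p)) (diff f p (ξ p)) := by
  rw [secondForm, covDeriv_congr hY]

/-- `C(X, U) = g(∇̄_X U, η)`: the transversal part of `∇̄_X U` drops out, because `η` is null. -/
theorem screenForm_eq_of_diff_eq {S : ScreenDistribution F K.g f} {W : Set N}
    {ξ X Y : Π p : N, TangentSpace 𝓘(ℝ, F) p} {η : Π p : N, TangentSpace 𝓘(ℝ, E) (f p)}
    (hW : IsNullFrame K.g f S W ξ η) (hp : p ∈ W)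
    (hY : ∀ᶠ q in 𝓝 p, diff f q (Y q) = (K.t i).U (f q)) :
    screenForm K.g f ξ η X Y p
      = K.g.inner (f p) (covDeriv K.g f (fun q => (K.t i).U (f q)) p (X p)) (η p) := by
  rw [screenForm, inducedConnection, covDeriv_congr hY, map_sub, map_smul, sub_apply, smul_apply,
    hW.null p hp, smul_zero, sub_zero]

theorem inducedForm_eq_u (hp : f p ∈ K.O i) {w y : TangentSpace 𝓘(ℝ, F) p}
    (hy : diff f p y = (K.t i).U (f p)) :
    inducedForm K.g f p w y = (K.t i).u (f p) (diff f p w) := by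
  have h1 : inducedForm K.g f p w y = K.g.inner (f p) (diff f p w) (diff f p y) := rfl
  rw [h1, hy, K.g.symm, (K.laws i _ hp).dual]

/-- `G` has no real eigenvector among horizontal vectors, because `G² = -1` on them. -/
theorem eq_zero_of_G_eq_smul (hp : f p ∈ K.O i) {ξ : TangentSpace 𝓘(ℝ, E) (f p)}
    (hξ : (K.t i).u (f p) ξ = 0 ∧ (K.t i).v (f p) ξ = 0) {c : ℝ}
    (h : (K.t i).G (f p) ξ = c • ξ) : ξ = 0 := by
  have h1 := (K.laws i _ hp).G_sq ξ
  rw [hξ.1, hξ.2, h, map_smul, h, smul_smul, zero_smul, zero_smul, add_zero, add_zero,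
    eq_neg_iff_add_eq_zero] at h1
  have h2 : (c * c + 1) • ξ = 0 := by rw [add_smul, one_smul, h1]
  exact (smul_eq_zero.1 h2).resolve_left (by nlinarith [mul_self_nonneg c])

/-- If `G Z = c ξ` with `Z` horizontal, then `Z = -G² Z = -c G ξ` is orthogonal to `ξ`, because `G`
is skew-adjoint. -/
theorem inner_eq_zero_of_G_eq_smul (hp : f p ∈ K.O i) {Z ξ : TangentSpace 𝓘(ℝ, E) (f p)}
    (hZ : (K.t i).u (f p) Z = 0 ∧ (K.t i).v (f p) Z = 0) {c : ℝ}
    (h : (K.t i).G (f p) Z = c • ξ) : K.g.inner (f p) ξ Z = 0 := by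
  have hl := K.laws i _ hp
  have h1 := hl.G_sq Z
  rw [hZ.1, hZ.2, h, map_smul, zero_smul, zero_smul, add_zero, add_zero] at h1
  have h2 : K.g.inner (f p) ξ ((K.t i).G (f p) ξ) = 0 := by
    have h3 := hl.G_skew ξ ξ
    rw [K.g.symm] at h3
    linarith
  have h4 : Z = -(c • (K.t i).G (f p) ξ) := by rw [h1, neg_neg]
  rw [h4, map_neg, map_smul, h2]
  simp

variable {S : ScreenDistribution F K.g f}

theorem diff_radical_horizontal (htangent : K.characteristic (f p) ≤
      LinearMap.range (diff (E := E) (F := F) f p).toLinearMap) (hp : f p ∈ K.O i)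
    {ξ : TangentSpace 𝓘(ℝ, F) p} (hξ : ξ ∈ radical F K.g f p) :
    (K.t i).u (f p) (diff f p ξ) = 0 ∧ (K.t i).v (f p) (diff f p ξ) = 0 :=
  horizontal_of_orthogonal hp fun _ hc => inner_eq_zero_of_mem_radical hξ (htangent hc)

theorem IsNullFrame.transversal_horizontal {W : Set N} {ξ : Π p : N, TangentSpace 𝓘(ℝ, F) p}
    {η : Π p : N, TangentSpace 𝓘(ℝ, E) (f p)} (hW : IsNullFrame K.g f S W ξ η) (hpW : p ∈ W)
    (hS : K.characteristic (f p) ≤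
      (S.space p).map (diff (E := E) (F := F) f p).toLinearMap) (hp : f p ∈ K.O i) :
    (K.t i).u (f p) (η p) = 0 ∧ (K.t i).v (f p) (η p) = 0 := by
  refine horizontal_of_orthogonal hp fun c hc => ?_
  obtain ⟨z, hz, rfl⟩ := hS hc
  rw [K.g.symm]
  exact hW.orthogonal p hpW z hz

/-- If the characteristic subbundle lies in the screen, then `PU = U`. -/
theorem eventually_diff_proj_eq (hf : IsNullHypersurface F K.g f)
    (hS : ∀ p : N, K.characteristic (f p) ≤
      (S.space p).map (diff (E := E) (F := F) f p).toLinearMap)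
    {Y : Π q : N, TangentSpace 𝓘(ℝ, F) q}
    (hY : ∀ᶠ q in 𝓝 p, f q ∈ K.O i ∧ diff f q (Y q) = (K.t i).U (f q)) :
    ∀ᶠ q in 𝓝 p, diff f q (S.proj Y q) = (K.t i).U (f q) := by
  filter_upwards [hY] with q hq
  obtain ⟨z, hz, hzU⟩ := hS q (K.U_mem_characteristic hq.1)
  have h1 : Y q = z := hf.immersion q (hq.2.trans hzU.symm)
  have h2 : S.proj Y q = Y q := ScreenDistribution.proj_eq_self (h1 ▸ hz)
  rw [h2, hq.2]

/-- For a totally umbilic hypersurface `B(w, U) = ρ u(w)` vanishes on horizontal `w`. With `Z = ξ`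
this makes the horizontal vector `ξ` an eigenvector of `G`. -/
theorem not_totallyUmbilic [Nonempty N] (hnormal : K.IsNormal) (hf : IsNullHypersurface F K.g f)
    (htangent : ∀ p : N, K.characteristic (f p) ≤
      LinearMap.range (diff (E := E) (F := F) f p).toLinearMap) : ¬ S.TotallyUmbilic := by
  intro h
  obtain ⟨p⟩ := ‹Nonempty N›
  obtain ⟨W, ξ, η, ρ, hpW, hW, -, hB⟩ := h p
  obtain ⟨i, hp⟩ := K.cover (f p)
  obtain ⟨Y, hY, hYU⟩ := exists_smoothFieldAt_diff_eq_U hf htangent hp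
  have hξ := diff_radical_horizontal (htangent p) hp (hW.mem_radical p hpW)
  obtain ⟨c, hc⟩ := exists_G_eq_smul hnormal hf (htangent p) hp (hW.mem_radical p hpW)
    (hW.ne_zero p hpW) hξ fun w hw => by
      have h1 := hB p hpW (coordField w) Y (smoothFieldAt_coordField w) hY
      rw [hW.secondForm_proj hf _ hpW hY, secondForm_eq_of_diff_eq (hYU.mono fun _ hq => hq.2),
        coordField_self, inducedForm_eq_u hp hYU.self_of_nhds.2, hw, mul_zero] at h1
      exact h1
  apply hW.ne_zero p hpW
  apply hf.immersion p
  rw [map_zero]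
  exact eq_zero_of_G_eq_smul hp hξ hc

/-- Here `C(w, U) = ρ u(w)` vanishes on horizontal `w`. With `Z = η` it follows that `g(ξ, η) = 0`,
against the normalization `g(ξ, η) = 1`. -/
theorem not_screenTotallyUmbilic [Nonempty N] (hnormal : K.IsNormal)
    (hf : IsNullHypersurface F K.g f)
    (htangent : ∀ p : N, K.characteristic (f p) ≤
      LinearMap.range (diff (E := E) (F := F) f p).toLinearMap)
    (hS : ∀ p : N, K.characteristic (f p) ≤
      (S.space p).map (diff (E := E) (F := F) f p).toLinearMap) : ¬ S.ScreenTotallyUmbilic := by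
  intro h
  obtain ⟨p⟩ := ‹Nonempty N›
  obtain ⟨W, ξ, η, ρ, hpW, hW, -, hC⟩ := h p
  obtain ⟨i, hp⟩ := K.cover (f p)
  obtain ⟨Y, hY, hYU⟩ := exists_smoothFieldAt_diff_eq_U hf htangent hp
  have hη := hW.transversal_horizontal hpW (hS p) hp
  obtain ⟨c, hc⟩ := exists_G_eq_smul hnormal hf (htangent p) hp (hW.mem_radical p hpW)
    (hW.ne_zero p hpW) hη fun w hw => by
      have h1 := hC p hpW (coordField w) Y (smoothFieldAt_coordField w) hY
      rw [screenForm_eq_of_diff_eq hW hpW (eventually_diff_proj_eq hf hS hYU),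
        coordField_self, inducedForm_eq_u hp hYU.self_of_nhds.2, hw, mul_zero] at h1
      exact h1
  have h1 := inner_eq_zero_of_G_eq_smul hp hη hc
  rw [hW.pairing p hpW] at h1
  exact one_ne_zero h1

/-- Here `g(∇̄_w U, η) = ψ g(∇̄_w U, ξ)` for all `w`. With `Z = η - ψ ξ` it follows that
`g(ξ, η) = ψ g(ξ, ξ) = 0`. -/
theorem not_screenConformal [Nonempty N] (hnormal : K.IsNormal)
    (hf : IsNullHypersurface F K.g f)
    (htangent : ∀ p : N, K.characteristic (f p) ≤
      LinearMap.range (diff (E := E) (F := F) f p).toLinearMap)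
    (hS : ∀ p : N, K.characteristic (f p) ≤
      (S.space p).map (diff (E := E) (F := F) f p).toLinearMap) : ¬ S.ScreenConformal := by
  intro h
  obtain ⟨p⟩ := ‹Nonempty N›
  obtain ⟨W, ξ, η, ψ, hpW, hW, -, -, hC⟩ := h p
  obtain ⟨i, hp⟩ := K.cover (f p)
  obtain ⟨Y, hY, hYU⟩ := exists_smoothFieldAt_diff_eq_U hf htangent hp
  have hξ := diff_radical_horizontal (htangent p) hp (hW.mem_radical p hpW)
  have hη := hW.transversal_horizontal hpW (hS p) hp
  have hZ : (K.t i).u (f p) (η p - ψ p • diff f p (ξ p)) = 0 ∧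
      (K.t i).v (f p) (η p - ψ p • diff f p (ξ p)) = 0 := by
    rw [map_sub, map_sub, map_smul, map_smul, hξ.1, hξ.2, hη.1, hη.2]
    simp
  obtain ⟨c, hc⟩ := exists_G_eq_smul hnormal hf (htangent p) hp (hW.mem_radical p hpW)
    (hW.ne_zero p hpW) hZ fun w _ => by
      have h1 := hC p hpW (coordField w) Y (smoothFieldAt_coordField w) hY
      rw [screenForm_eq_of_diff_eq hW hpW (eventually_diff_proj_eq hf hS hYU),
        secondForm_eq_of_diff_eq (hYU.mono fun _ hq => hq.2), coordField_self] at h1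
      rw [map_sub, map_smul, h1, smul_eq_mul, sub_self]
  have h1 := inner_eq_zero_of_G_eq_smul hp hZ hc
  have h2 : K.g.inner (f p) (diff f p (ξ p)) (diff f p (ξ p)) = 0 := hW.mem_radical p hpW (ξ p)
  rw [map_sub, map_smul, hW.pairing p hpW, h2] at h1
  simp at h1

end CharacteristicField

end ComplexContact

end

theorem mainTheorem3
    -- the ambient manifold, complex contact metric and normal, of index `4q` with `0 < q < n`
    {E : Type*} [NormedAddCommGroup E] [NormedSpace ℂ E] [FiniteDimensional ℂ E]
    {M : Type*} [TopologicalSpace M] [ChartedSpace E M] [IsManifold 𝓘(ℂ, E) ∞ M]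
    {n q : ℕ} {A : Type*} (K : ComplexContact.ComplexContactMetricStructure n A E M)
    (hq : 0 < q) (hqn : q < n) (hindex : ∀ x, K.g.index x = 4 * q) (hnormal : K.IsNormal)
    -- the null hypersurface, tangent to the characteristic subbundle
    {F : Type*} [NormedAddCommGroup F] [NormedSpace ℝ F]
    {N : Type*} [TopologicalSpace N] [ChartedSpace F N] [IsManifold 𝓘(ℝ, F) ∞ N] [Nonempty N]
    (f : N → M) (hf : ComplexContact.IsNullHypersurface F K.g f)
    (htangent : ∀ p : N, K.characteristic (f p) ≤
      LinearMap.range (ComplexContact.diff (E := E) (F := F) f p).toLinearMap)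
    -- its screen distribution
    (S : ComplexContact.ScreenDistribution F K.g f) :
    ¬ S.TotallyUmbilic ∧
    ((∀ p : N, K.characteristic (f p) ≤ (S.space p).map (ComplexContact.diff (E := E) (F := F) f p).toLinearMap) →
      ¬ S.ScreenTotallyUmbilic ∧ ¬ S.ScreenConformal) := by
  exact ⟨ComplexContact.not_totallyUmbilic hnormal hf htangent, fun hS =>
    ⟨ComplexContact.not_screenTotallyUmbilic hnormal hf htangent hS,
      ComplexContact.not_screenConformal hnormal hf htangent hS⟩⟩
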